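/- Let $d\in\mathbb N$, $0<s<1<p<\infty$ with $sp<d$, and let $\Omega\subset\mathbb R^d$ be a bounded open set containing $0$. For $0\le m\le sp$ put $p^*_s(m)=\frac{p(d-m)}{d-sp}$ and $p^*_s=p^*_s(0)$, and let $\alpha,\beta>1$ satisfy $\alpha+\beta=q\in[p,p^*_s(m)]$. Write $$[u]_{s,p}^p=\iint_{\mathbb R^d\times\mathbb R^d}\frac{|u(x)-u(y)|^p}{|x-y|^{d+sp}}\,dx\,dy .$$ For an open set $U\subset\mathbb R^d$ let $W^{s,p}_0(U)$ be the space of all $u\in L^{p^*_s}(\mathbb R^d)$ with $[u]_{s,p}<\infty$ and $u=0$ a.e. in $\mathbb R^d\setminus U$, and let $$S_{\alpha,\beta}(U)=\inf_{u,v\in W^{s,p}_0(U)\setminus\{0\}}\frac{[u]_{s,p}^p+[v]_{s,p}^p}{\left(\int_U\frac{|u|^\alpha|v|^\beta}{|x|^m}\,dx\right)^{p/q}},$$ where the quotient is $+\infty$ if the integral vanishes. A pair $u,v\in W^{s,p}_0(U)\setminus\{0\}$ that attains this infimum is called a ground state solution on $U$ of the homogeneous system $$(-\Delta_p)^su=\frac{\alpha}{q}\frac{|u|^{\alpha-2}u|v|^\beta}{|x|^m},\qquad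 (-\Delta_p)^sv=\frac{\beta}{q}\frac{|v|^{\beta-2}v|u|^\alpha}{|x|^m}\ \text{ in }U,\qquad u=v=0\ \text{ in }\mathbb R^d\setminus U .$$ (i) If $q<p^*_s(m)$, then there is a ground state solution $(u,v)$ on $\Omega$ with $u>0$ and $v>0$ a.e. in $\Omega$. (ii) If $q=p^*_s$ (which forces $m=0$), then there is no ground state solution on $\Omega$; more generally, there is none on any open set $U\subset\mathbb R^d$ whose complement has positive Lebesgue measure. -/

import Mathlib

open MeasureTheory
open scoped ENNReal

noncomputable section

namespace FracSystem

/-- The fractional Hardy-Sobolev exponent `p*_s(m) = p (d - m) / (d - s p)`. -/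
def critExp (d : ℕ) (s p m : ℝ) : ℝ := p * ((d : ℝ) - m) / ((d : ℝ) - s * p)

/-- The `p`-th power `[u]_{s,p}^p` of the Gagliardo seminorm on `ℝ^d`, with value `∞` allowed. -/
def gagliardoPow {d : ℕ} (s p : ℝ) (u : EuclideanSpace ℝ (Fin d) → ℝ) : ℝ≥0∞ :=
  ∫⁻ z : EuclideanSpace ℝ (Fin d) × EuclideanSpace ℝ (Fin d),
    ENNReal.ofReal (|u z.1 - u z.2| ^ p / ‖z.1 - z.2‖ ^ ((d : ℝ) + s * p))

/-- The homogeneous fractional Sobolev space `D^{s,p}(ℝ^d)`: the functions in `L^{p*_s}(ℝ^d)` with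
finite Gagliardo seminorm (functions are taken up to a.e. equality). -/
def MemD {d : ℕ} (s p : ℝ) (u : EuclideanSpace ℝ (Fin d) → ℝ) : Prop :=
  MemLp u (ENNReal.ofReal (critExp d s p 0)) volume ∧ gagliardoPow s p u < ∞

/-- The space `W_0^{s,p}(Ω)`: the elements of `D^{s,p}(ℝ^d)` that vanish a.e. outside `Ω`. -/
def MemW0 {d : ℕ} (s p : ℝ) (Ω : Set (EuclideanSpace ℝ (Fin d)))
    (u : EuclideanSpace ℝ (Fin d) → ℝ) : Prop :=
  MemD s p u ∧ ∀ᵐ x : EuclideanSpace ℝ (Fin d), x ∉ Ω → u x = 0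

/-- `W_0^{s,p}(Ω) ∖ {0}`. -/
def W0NonZero {d : ℕ} (s p : ℝ) (Ω : Set (EuclideanSpace ℝ (Fin d))) :
    Set (EuclideanSpace ℝ (Fin d) → ℝ) :=
  {u | MemW0 s p Ω u ∧ ¬ u =ᵐ[volume] 0}

/-- The coupling integral `∫_Ω |u|^α |v|^β / |x|^m dx`. -/
def coupling {d : ℕ} (m α β : ℝ) (Ω : Set (EuclideanSpace ℝ (Fin d)))
    (u v : EuclideanSpace ℝ (Fin d) → ℝ) : ℝ≥0∞ :=
  ∫⁻ x in Ω, ENNReal.ofReal (|u x| ^ α * |v x| ^ β / ‖x‖ ^ m)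

/-- The quotient `([u]^p + [v]^p) / (∫_Ω |u|^α |v|^β / |x|^m dx)^(p/q)` with `q = α + β`. It lies in
`[0, ∞]`; for `u, v ≠ 0` its numerator is positive, so it is `∞` where the coupling integral is `0`,
and such pairs do not count in the infimum below. -/
def rayleigh {d : ℕ} (s p m α β : ℝ) (Ω : Set (EuclideanSpace ℝ (Fin d)))
    (u v : EuclideanSpace ℝ (Fin d) → ℝ) : ℝ≥0∞ :=
  (gagliardoPow s p u + gagliardoPow s p v) / coupling m α β Ω u v ^ (p / (α + β))

/-- The constant `S_{α,β}` of `Ω`: the infimum of the quotient over `u, v ∈ W_0^{s,p}(Ω) ∖ {0}`. -/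
def bestConst {d : ℕ} (s p m α β : ℝ) (Ω : Set (EuclideanSpace ℝ (Fin d))) : ℝ≥0∞ :=
  ⨅ u ∈ W0NonZero s p Ω, ⨅ v ∈ W0NonZero s p Ω, rayleigh s p m α β Ω u v

/-- `(u, v)` is a ground state solution of the homogeneous system on `Ω`: it minimizes
`S_{α,β}`. -/
def IsGroundState {d : ℕ} (s p m α β : ℝ) (Ω : Set (EuclideanSpace ℝ (Fin d)))
    (u v : EuclideanSpace ℝ (Fin d) → ℝ) : Prop :=
  u ∈ W0NonZero s p Ω ∧ v ∈ W0NonZero s p Ω ∧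
    rayleigh s p m α β Ω u v = bestConst s p m α β Ω

end FracSystem

end

/-!
The proof rests on three facts about the Gagliardo seminorm `[u]` on `D^{s,p}(ℝ^d)`.

*Sobolev inequality* (`exists_powInt_le`). Around a point `x` with `u(x) ≠ 0` take the ball of
volume a constant times `N |u(x)|^(-p*)`, where `N = ∫ |u|^{p*}` and `p* = p*_s`. By Chebyshev,
`|u|` is below `|u(x)| / 2` on half of it, so that `∫ |u(x) - u(y)|^p / |x - y|^(d + s p) dy` is at
least a constant times `|u(x)|^{p*} N^(-s p / d)`; integration in `x` finishes the proof because
`N < ∞` is part of the definition of the space.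

*Compactness* (`exists_subseq_tendsto_ae`). Means over a grid of cubes of side `h` approximate `u`
in `L¹` up to `O(h^s)`, and a diagonal subsequence makes all the means converge.

*Maximum principle* (`ae_pos_of_gagliardoPow_le_max`). Suppose that `u ≥ 0` is not zero and that
`[u] ≤ [max(u, ε ψ)]` for all `ε > 0`, where `0 ≤ ψ ≤ 1`. If `u` vanished on a set of positive
measure where `ψ > 0`, then passing to `max(u, ε ψ)` would lower `[u]^p` by an amount linear in
`ε`, from the pairs `(x, y)` with `u(x)` large and `u(y) = 0`, and raise it by at most `ε^p [ψ]^p`;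
as `p > 1`, this is absurd for small `ε`. A minimizing pair has the property assumed, because
raising `u` raises the coupling integral.

In the subcritical case the coupling density of a bounded sequence is bounded in some `L^θ` with
`θ > 1` (`exists_rpow_couplingDens_le`), hence a normalized minimizing sequence keeps its coupling
integral in the limit, Fatou's lemma handles the seminorms, and the absolute values of the
minimizers are positive by the maximum principle.

In the critical case `q = p*_s`, `m = 0` the quotient is invariant under translations and
dilations, so that the best constant of any nonempty open set bounds from below the quotient of compactly
supported pairs, and by approximation of all nonnegative pairs in `D^{s,p}(ℝ^d)`
(`bestConst_mul_coupling_univ_le`). A ground state on `U` would therefore minimize on the whole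
space, and its absolute value would be positive almost everywhere by the maximum principle; but it
vanishes on the complement of `U`, which has positive measure.
-/

noncomputable section

namespace FracSystem

open Filter Topology

/-- The space `ℝ^d` with its Euclidean norm. -/
abbrev Euc (d : ℕ) : Type := EuclideanSpace ℝ (Fin d)

/-- The modular `∫ |u|^r dx`, the `r`-th power of the `L^r` norm. -/
def powInt {d : ℕ} (r : ℝ) (u : Euc d → ℝ) : ℝ≥0∞ := ∫⁻ x, ENNReal.ofReal (|u x| ^ r)

/-- The Gagliardo density `|u(x) - u(y)|^p / |x - y|^(d + s p)`. -/
def gagDens {d : ℕ} (s p : ℝ) (u : Euc d → ℝ) (x y : Euc d) : ℝ≥0∞ :=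
  ENNReal.ofReal (|u x - u y| ^ p / ‖x - y‖ ^ ((d : ℝ) + s * p))

/-! ### Exponents -/

section Exponent

variable {d : ℕ} {s p : ℝ}

lemma critExp_mul (hd : s * p < d) : critExp d s p 0 * ((d : ℝ) - s * p) = p * d := by
  have : (d : ℝ) - s * p ≠ 0 := by linarith
  unfold critExp
  rw [div_mul_cancel₀ _ this, sub_zero]

lemma lt_critExp (hs0 : 0 < s) (hp : 1 < p) (hd : s * p < d) : p < critExp d s p 0 := by
  have h1 : 0 < s * p := by positivity
  have : 0 < (d : ℝ) - s * p := by linarith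
  unfold critExp
  rw [lt_div_iff₀ this]
  nlinarith

lemma add_critExp_mul (hs0 : 0 < s) (hp : 1 < p) (hd : s * p < d) :
    p + critExp d s p 0 * (s * p / d) = critExp d s p 0 := by
  have h1 : 0 < s * p := by positivity
  have h2 : (d : ℝ) ≠ 0 := by linarith
  have h := critExp_mul (d := d) (s := s) (p := p) hd
  field_simp
  linarith

end Exponent

/-! ### Modulars and Gagliardo densities -/

section Basic

variable {d : ℕ} {s p r : ℝ} {u v : Euc d → ℝ}

lemma memLp_iff_powInt (hr : 0 < r) :
    MemLp u (ENNReal.ofReal r) volume ↔ AEMeasurable u ∧ powInt r u < ∞ := by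
  have h0 : ENNReal.ofReal r ≠ 0 := by simpa using hr
  unfold MemLp powInt
  rw [aestronglyMeasurable_iff_aemeasurable,
    eLpNorm_lt_top_iff_lintegral_rpow_enorm_lt_top h0 ENNReal.ofReal_ne_top,
    ENNReal.toReal_ofReal hr.le]
  simp_rw [Real.enorm_eq_ofReal_abs, ENNReal.ofReal_rpow_of_nonneg (abs_nonneg _) hr.le]

lemma memD_iff (hs0 : 0 < s) (hp : 1 < p) (hd : s * p < d) :
    MemD s p u ↔ AEMeasurable u ∧ powInt (critExp d s p 0) u < ∞ ∧ gagliardoPow s p u < ∞ := by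
  have := lt_critExp hs0 hp hd
  unfold MemD
  rw [memLp_iff_powInt (by linarith), and_assoc]

lemma gagliardoPow_eq_dens : gagliardoPow s p u =
    ∫⁻ z : Euc d × Euc d, gagDens s p u z.1 z.2 := rfl

lemma aemeasurable_gagDens (hu : AEMeasurable u) :
    AEMeasurable (fun z : Euc d × Euc d ↦ gagDens s p u z.1 z.2)
      ((volume : Measure (Euc d)).prod volume) := by
  unfold gagDens
  have h1 := hu.comp_quasiMeasurePreserving
    (Measure.quasiMeasurePreserving_fst (μ := (volume : Measure (Euc d)))
      (ν := (volume : Measure (Euc d))))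
  have h2 := hu.comp_quasiMeasurePreserving
    (Measure.quasiMeasurePreserving_snd (μ := (volume : Measure (Euc d)))
      (ν := (volume : Measure (Euc d))))
  have h3 : AEMeasurable (fun z : Euc d × Euc d ↦ |u z.1 - u z.2|)
      ((volume : Measure (Euc d)).prod volume) :=
    continuous_abs.measurable.comp_aemeasurable (h1.sub h2)
  refine ENNReal.measurable_ofReal.comp_aemeasurable ((h3.pow_const p).div ?_)
  exact Measurable.aemeasurable (by fun_prop)

lemma aemeasurable_gagDens_right (hu : AEMeasurable u) (x : Euc d) :
    AEMeasurable (gagDens s p u x) := by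
  unfold gagDens
  have h3 : AEMeasurable (fun y : Euc d ↦ |u x - u y|) :=
    continuous_abs.measurable.comp_aemeasurable (aemeasurable_const.sub hu)
  refine ENNReal.measurable_ofReal.comp_aemeasurable ((h3.pow_const p).div ?_)
  exact Measurable.aemeasurable (by fun_prop)

lemma gagliardoPow_eq_iterated (hu : AEMeasurable u) :
    gagliardoPow s p u = ∫⁻ x, ∫⁻ y, gagDens s p u x y :=
  lintegral_prod _ (aemeasurable_gagDens hu)

lemma gagDens_mono (hp : 0 ≤ p) {x y : Euc d} (h : |u x - u y| ≤ |v x - v y|) :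
    gagDens s p u x y ≤ gagDens s p v x y := by
  unfold gagDens
  gcongr

lemma gagliardoPow_mono (hp : 0 ≤ p) (h : ∀ x y, |u x - u y| ≤ |v x - v y|) :
    gagliardoPow s p u ≤ gagliardoPow s p v :=
  lintegral_mono fun _ ↦ gagDens_mono hp (h _ _)

lemma gagliardoPow_abs_le (hp : 0 ≤ p) :
    gagliardoPow s p (fun x ↦ |u x|) ≤ gagliardoPow s p u :=
  gagliardoPow_mono hp fun _ _ ↦ abs_abs_sub_abs_le _ _

lemma gagliardoPow_const_mul (t : ℝ) :
    gagliardoPow s p (fun x ↦ t * u x) = ENNReal.ofReal (|t| ^ p) * gagliardoPow s p u := by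
  rw [gagliardoPow_eq_dens, gagliardoPow_eq_dens, ← lintegral_const_mul' _ _ ENNReal.ofReal_ne_top]
  refine lintegral_congr fun z ↦ ?_
  unfold gagDens
  rw [← ENNReal.ofReal_mul (by positivity), ← mul_sub, abs_mul,
    Real.mul_rpow (abs_nonneg _) (abs_nonneg _), mul_div_assoc]

lemma powInt_const_mul (t : ℝ) :
    powInt r (fun x ↦ t * u x) = ENNReal.ofReal (|t| ^ r) * powInt r u := by
  unfold powInt
  rw [← lintegral_const_mul' _ _ ENNReal.ofReal_ne_top]
  refine lintegral_congr fun x ↦ ?_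
  rw [← ENNReal.ofReal_mul (by positivity), abs_mul, Real.mul_rpow (abs_nonneg _) (abs_nonneg _)]

lemma powInt_mono (hr : 0 ≤ r) (h : ∀ x, |u x| ≤ |v x|) : powInt r u ≤ powInt r v :=
  lintegral_mono fun x ↦ ENNReal.ofReal_le_ofReal (Real.rpow_le_rpow (abs_nonneg _) (h x) hr)

lemma aemeasurable_powInt (hu : AEMeasurable u) :
    AEMeasurable (fun x ↦ ENNReal.ofReal (|u x| ^ r)) :=
  ENNReal.measurable_ofReal.comp_aemeasurable
    ((continuous_abs.measurable.comp_aemeasurable hu).pow_const r)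

lemma powInt_eq_zero (hu : AEMeasurable u) (hr : 0 < r) (h : powInt r u = 0) :
    u =ᵐ[volume] 0 := by
  unfold powInt at h
  rw [lintegral_eq_zero_iff' (aemeasurable_powInt hu)] at h
  filter_upwards [h] with x hx
  have h1 : |u x| ^ r ≤ 0 := by simpa using hx
  have h2 : |u x| ^ r = 0 := le_antisymm h1 (by positivity)
  rw [Real.rpow_eq_zero (abs_nonneg _) hr.ne'] at h2
  simpa using h2

/-- Fatou's lemma for the sum of two Gagliardo seminorms. -/
lemma gagliardoPow_add_le_liminf (hp : 0 < p) {f g : ℕ → Euc d → ℝ}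
    (hf : ∀ n, AEMeasurable (f n)) (hg : ∀ n, AEMeasurable (g n)) (hu : AEMeasurable u)
    (hfu : ∀ᵐ x, Tendsto (fun n ↦ f n x) atTop (𝓝 (u x)))
    (hgv : ∀ᵐ x, Tendsto (fun n ↦ g n x) atTop (𝓝 (v x))) :
    gagliardoPow s p u + gagliardoPow s p v ≤
      liminf (fun n ↦ gagliardoPow s p (f n) + gagliardoPow s p (g n)) atTop := by
  have hdens : ∀ {h : ℕ → Euc d → ℝ} {w : Euc d → ℝ},
      (∀ᵐ x, Tendsto (fun n ↦ h n x) atTop (𝓝 (w x))) →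
      ∀ᵐ z : Euc d × Euc d ∂((volume : Measure (Euc d)).prod volume),
        Tendsto (fun n ↦ gagDens s p (h n) z.1 z.2) atTop (𝓝 (gagDens s p w z.1 z.2)) := by
    intro h w hw
    have h1 : ∀ᵐ z : Euc d × Euc d ∂((volume : Measure (Euc d)).prod volume),
        Tendsto (fun n ↦ h n z.1) atTop (𝓝 (w z.1)) := Measure.quasiMeasurePreserving_fst.ae hw
    have h2 : ∀ᵐ z : Euc d × Euc d ∂((volume : Measure (Euc d)).prod volume),
        Tendsto (fun n ↦ h n z.2) atTop (𝓝 (w z.2)) := Measure.quasiMeasurePreserving_snd.ae hw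
    filter_upwards [h1, h2] with z hz1 hz2
    unfold gagDens
    refine ENNReal.tendsto_ofReal (Tendsto.div_const ?_ _)
    exact ((hz1.sub hz2).abs).rpow_const (Or.inr hp.le)
  have hsum : ∀ {a b : Euc d → ℝ}, AEMeasurable a → gagliardoPow s p a + gagliardoPow s p b =
      ∫⁻ z, (gagDens s p a z.1 z.2 + gagDens s p b z.1 z.2)
        ∂((volume : Measure (Euc d)).prod volume) := fun ha ↦
    (lintegral_add_left' (aemeasurable_gagDens ha) _).symm
  calc gagliardoPow s p u + gagliardoPow s p v
      ≤ ∫⁻ z, liminf (fun n ↦ gagDens s p (f n) z.1 z.2 + gagDens s p (g n) z.1 z.2) atTop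
          ∂((volume : Measure (Euc d)).prod volume) := by
        rw [hsum hu]
        refine lintegral_mono_ae ?_
        filter_upwards [hdens hfu, hdens hgv] with z hz1 hz2
        exact (hz1.add hz2).liminf_eq.ge
    _ ≤ liminf (fun n ↦ ∫⁻ z, (gagDens s p (f n) z.1 z.2 + gagDens s p (g n) z.1 z.2)
          ∂((volume : Measure (Euc d)).prod volume)) atTop :=
        lintegral_liminf_le' fun n ↦ (aemeasurable_gagDens (hf n)).add (aemeasurable_gagDens (hg n))
    _ = _ := by simp_rw [hsum (hf _)]

lemma powInt_le_liminf (hr : 0 < r) {f : ℕ → Euc d → ℝ} (hf : ∀ n, AEMeasurable (f n))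
    (h : ∀ᵐ x, Tendsto (fun n ↦ f n x) atTop (𝓝 (u x))) :
    powInt r u ≤ liminf (fun n ↦ powInt r (f n)) atTop := by
  calc powInt r u
      ≤ ∫⁻ x, liminf (fun n ↦ ENNReal.ofReal (|f n x| ^ r)) atTop := by
        refine lintegral_mono_ae ?_
        filter_upwards [h] with x hx
        refine le_of_eq (Tendsto.liminf_eq ?_).symm
        exact ENNReal.tendsto_ofReal (hx.abs.rpow_const (Or.inr hr.le))
    _ ≤ _ := lintegral_liminf_le' fun n ↦ aemeasurable_powInt (hf n)

end Basic

/-! ### The fractional Sobolev inequality -/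

section Sobolev

variable {d : ℕ} {s p : ℝ} {u : Euc d → ℝ}

/-- Pointwise form of the fractional Sobolev inequality: on at least half of the ball around `x`
of volume `2^(1+p*) N |u(x)|^(-p*)` the function `u` is smaller than `|u(x)|/2`, which forces the
Gagliardo density at `x` to be large. -/
lemma rpow_le_mul_lintegral_gagDens (hs0 : 0 < s) (hp : 1 < p) (hd : s * p < d) :
    ∃ C : ℝ, 0 < C ∧ ∀ u : Euc d → ℝ, AEMeasurable u → powInt (critExp d s p 0) u ≠ 0 →
      powInt (critExp d s p 0) u ≠ ∞ → ∀ x,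
      ENNReal.ofReal (|u x| ^ critExp d s p 0) ≤
        ENNReal.ofReal C * powInt (critExp d s p 0) u ^ (s * p / d) * ∫⁻ y, gagDens s p u x y := by
  have hsp : 0 < s * p := by positivity
  have hd0 : (0 : ℝ) < d := by linarith
  set r := critExp d s p 0 with hr_def
  have hr0 : 0 < r := by have := lt_critExp hs0 hp hd; linarith
  set θ := s * p / d with hθ
  set ω : ℝ := (volume (Metric.ball (0 : Euc d) 1)).toReal with hω
  have hωpos : 0 < ω := by
    refine ENNReal.toReal_pos (Metric.measure_ball_pos _ _ one_pos).ne' measure_ball_lt_top.ne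
  refine ⟨2 ^ p * (2 / ω) ^ (1 + θ) * (2 ^ r) ^ θ, by positivity, fun u hu hN0 hN x ↦ ?_⟩
  set N := powInt r u
  set Nr := N.toReal with hNr
  have hNrpos : 0 < Nr := ENNReal.toReal_pos hN0 hN
  have hNeq : N = ENNReal.ofReal Nr := (ENNReal.ofReal_toReal hN).symm
  rcases (abs_nonneg (u x)).eq_or_lt with h0 | ha
  · rw [← h0, Real.zero_rpow hr0.ne']
    simp
  set a := |u x| with ha_def
  set m := 2 ^ r * Nr / a ^ r with hm_def
  have hm : 0 < m := by positivity
  set ρ := (2 * m / ω) ^ (1 / (d : ℝ)) with hρ_def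
  have hρ : 0 < ρ := by positivity
  have hρd : ω * ρ ^ d = 2 * m := by
    rw [hρ_def, ← Real.rpow_natCast, ← Real.rpow_mul (by positivity), one_div,
      inv_mul_cancel₀ hd0.ne', Real.rpow_one]
    field_simp
  -- the set where `u` is not small
  set bad : Set (Euc d) := {y | ENNReal.ofReal ((a / 2) ^ r) ≤ ENNReal.ofReal (|u y| ^ r)}
  have hbad : volume bad ≤ ENNReal.ofReal m := by
    have h1 := mul_meas_ge_le_lintegral₀ (aemeasurable_powInt (r := r) hu)
      (ENNReal.ofReal ((a / 2) ^ r))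
    change _ * volume bad ≤ N at h1
    have h2 : m = Nr / (a / 2) ^ r := by
      rw [hm_def, Real.div_rpow ha.le (by norm_num)]
      field_simp
    rw [h2, ENNReal.ofReal_div_of_pos (by positivity), ← hNeq]
    rw [ENNReal.le_div_iff_mul_le (by left; simp; positivity) (by left; simp), mul_comm]
    exact h1
  have hball : volume (Metric.ball x ρ) = ENNReal.ofReal (2 * m) := by
    rw [Measure.addHaar_ball_of_pos _ _ hρ, finrank_euclideanSpace, Fintype.card_fin, ← hρd,
      mul_comm ω, ENNReal.ofReal_mul (by positivity), hω, ENNReal.ofReal_toReal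
        measure_ball_lt_top.ne]
  have hgood : ENNReal.ofReal m ≤ volume (Metric.ball x ρ \ bad) := by
    have h1 : volume (Metric.ball x ρ) ≤ volume (Metric.ball x ρ \ bad) + volume bad := by
      refine (measure_mono ?_).trans (measure_union_le _ _)
      intro y hy
      by_cases hb : y ∈ bad
      · exact Or.inr hb
      · exact Or.inl ⟨hy, hb⟩
    rw [hball] at h1
    have h2 : ENNReal.ofReal m + ENNReal.ofReal m ≤
        volume (Metric.ball x ρ \ bad) + ENNReal.ofReal m := by
      rw [← ENNReal.ofReal_add hm.le hm.le, ← two_mul]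
      exact h1.trans (by gcongr)
    exact (ENNReal.add_le_add_iff_right ENNReal.ofReal_ne_top).1 h2
  have hdens : ∀ y ∈ Metric.ball x ρ \ bad,
      ENNReal.ofReal ((a / 2) ^ p / ρ ^ ((d : ℝ) + s * p)) ≤ gagDens s p u x y := by
    rintro y ⟨hy, hyb⟩
    have h1 : |u y| < a / 2 := by
      by_contra! h
      exact hyb (ENNReal.ofReal_le_ofReal (Real.rpow_le_rpow (by positivity) h hr0.le))
    have h2 : a / 2 ≤ |u x - u y| := by
      have := abs_sub_abs_le_abs_sub (u x) (u y)
      linarith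
    have hne : x ≠ y := by
      rintro rfl
      linarith
    have h3 : 0 < ‖x - y‖ := norm_pos_iff.2 (sub_ne_zero.2 hne)
    have h4 : ‖x - y‖ ≤ ρ := by
      rw [← dist_eq_norm, dist_comm]; exact (Metric.mem_ball.1 hy).le
    unfold gagDens
    refine ENNReal.ofReal_le_ofReal ?_
    gcongr
  have hG : ENNReal.ofReal ((a / 2) ^ p / ρ ^ ((d : ℝ) + s * p)) * ENNReal.ofReal m ≤
      ∫⁻ y, gagDens s p u x y := by
    refine le_trans ?_ (mul_meas_ge_le_lintegral₀ (aemeasurable_gagDens_right hu x)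
      (ENNReal.ofReal ((a / 2) ^ p / ρ ^ ((d : ℝ) + s * p))))
    gcongr
    exact hgood.trans (measure_mono hdens)
  have hρe : ρ ^ ((d : ℝ) + s * p) = (2 * m / ω) ^ (1 + θ) := by
    rw [hρ_def, ← Real.rpow_mul (by positivity)]
    congr 1
    rw [hθ]
    field_simp
  have key : a ^ r = 2 ^ p * (2 / ω) ^ (1 + θ) * (2 ^ r) ^ θ * Nr ^ θ *
      ((a / 2) ^ p / ρ ^ ((d : ℝ) + s * p) * m) := by
    have e1 : (2 * m / ω) ^ (1 + θ) = (2 / ω) ^ (1 + θ) * (m * m ^ θ) := by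
      rw [show 2 * m / ω = 2 / ω * m by ring, Real.mul_rpow (by positivity) hm.le,
        Real.rpow_add hm 1 θ, Real.rpow_one]
    have e2 : m ^ θ = (2 ^ r) ^ θ * Nr ^ θ / a ^ (r * θ) := by
      rw [hm_def, Real.div_rpow (by positivity) (by positivity),
        Real.mul_rpow (by positivity) hNrpos.le, Real.rpow_mul ha.le]
    have e3 : a ^ r = a ^ p * a ^ (r * θ) := by
      rw [← Real.rpow_add ha, hr_def, hθ, add_critExp_mul hs0 hp hd]
    rw [hρe, e1, e2, Real.div_rpow ha.le (by norm_num), e3]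
    have : 0 < a ^ (r * θ) := by positivity
    have : 0 < (2 / ω) ^ (1 + θ) := by positivity
    field_simp
  rw [key, ENNReal.ofReal_mul (by positivity), ENNReal.ofReal_mul (by positivity),
    ENNReal.ofReal_mul (by positivity) (q := m), hNeq,
    ENNReal.ofReal_rpow_of_nonneg hNrpos.le (by positivity)]
  gcongr

/-- The fractional Sobolev inequality on `D^{s,p}(ℝ^d)`. Integrating the pointwise form gives
`N ≤ C N^(s p / d) [u]^p` for the modular `N`; since `N` is finite and `s p < d`, one can divide. -/
theorem exists_powInt_le (hs0 : 0 < s) (hp : 1 < p) (hd : s * p < d) :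
    ∃ C : ℝ, 0 < C ∧ ∀ u : Euc d → ℝ, MemD s p u →
      powInt (critExp d s p 0) u ≤
        (ENNReal.ofReal C * gagliardoPow s p u) ^ ((d : ℝ) / (d - s * p)) := by
  have hsp : 0 < s * p := by positivity
  have hd0 : (0 : ℝ) < d := by linarith
  have hds : (0 : ℝ) < d - s * p := by linarith
  obtain ⟨C, hC, h⟩ := rpow_le_mul_lintegral_gagDens hs0 hp hd
  refine ⟨C, hC, fun u hu ↦ ?_⟩
  obtain ⟨hm, hN, hg⟩ := (memD_iff hs0 hp hd).1 hu
  set N := powInt (critExp d s p 0) u with hN_def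
  by_cases hN0 : N = 0
  · rw [hN0]; exact zero_le
  have h1 : N ≤ ENNReal.ofReal C * N ^ (s * p / d) * gagliardoPow s p u := by
    rw [gagliardoPow_eq_iterated hm, ← lintegral_const_mul'']
    · exact lintegral_mono (h u hm hN0 hN.ne)
    · exact (aemeasurable_gagDens hm).lintegral_prod_right'
  have h2 : N ^ (1 - s * p / d) ≤ ENNReal.ofReal C * gagliardoPow s p u := by
    rw [ENNReal.rpow_sub _ _ hN0 hN.ne, ENNReal.rpow_one]
    refine ENNReal.div_le_of_le_mul ?_
    calc N ≤ _ := h1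
      _ = _ := by ring
  calc N = (N ^ (1 - s * p / d)) ^ ((d : ℝ) / (d - s * p)) := by
        rw [← ENNReal.rpow_mul]
        have : (1 - s * p / d) * ((d : ℝ) / (d - s * p)) = 1 := by field_simp
        rw [this, ENNReal.rpow_one]
    _ ≤ _ := by gcongr

lemma gagliardoPow_ne_zero (hs0 : 0 < s) (hp : 1 < p) (hd : s * p < d) (hu : MemD s p u)
    (h0 : ¬ u =ᵐ[volume] 0) : gagliardoPow s p u ≠ 0 := by
  intro h
  obtain ⟨C, hC, hS⟩ := exists_powInt_le hs0 hp hd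
  have h1 := hS u hu
  have : 0 < (d : ℝ) / (d - s * p) := by
    have : 0 < s * p := by positivity
    apply div_pos <;> linarith
  rw [h, mul_zero, ENNReal.zero_rpow_of_pos this] at h1
  have := lt_critExp hs0 hp hd
  exact h0 (powInt_eq_zero ((memD_iff hs0 hp hd).1 hu).1 (by linarith) (le_antisymm h1 zero_le))

end Sobolev

/-! ### The truncated kernel -/

section Kernel

variable {d : ℕ} {s p : ℝ} {u : Euc d → ℝ}

/-- The truncated kernel `min(L |z|, 1)^p / |z|^(d + s p)`, which dominates the Gagliardo density of
every `L`-Lipschitz function of oscillation at most `1`. -/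
def truncKer (s p L : ℝ) (z : Euc d) : ℝ≥0∞ :=
  ENNReal.ofReal (min (L * ‖z‖) 1 ^ p / ‖z‖ ^ ((d : ℝ) + s * p))

lemma measurable_truncKer (L : ℝ) : Measurable (truncKer (d := d) s p L) := by
  unfold truncKer
  fun_prop

lemma truncKer_neg (L : ℝ) (z : Euc d) : truncKer s p L (-z) = truncKer s p L z := by
  simp [truncKer]

lemma lintegral_ball_norm_rpow_neg_lt_top (hd : 1 ≤ d) {a : ℝ} (ha : a < d) (R : ℝ) :
    ∫⁻ x in Metric.ball (0 : Euc d) R, ENNReal.ofReal (‖x‖ ^ (-a)) < ∞ := by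
  have h := integrableOn_ball_of_norm_le_rpow (μ := (volume : Measure (Euc d)))
    (f := fun x : Euc d ↦ ‖x‖ ^ (-a)) (C := 1) (α := a) (r := R)
    (by rwa [finrank_euclideanSpace, Fintype.card_fin])
    (by rwa [finrank_euclideanSpace, Fintype.card_fin])
    (Eventually.of_forall fun x ↦ by
      rw [Real.norm_of_nonneg (by positivity), one_mul])
    (measurable_norm.pow_const _).aestronglyMeasurable
  have h2 := h.2
  rw [hasFiniteIntegral_iff_ofReal (Eventually.of_forall fun x ↦ by positivity)] at h2
  exact h2

lemma lintegral_truncKer_lt_top (hs0 : 0 < s) (hs1 : s < 1) (hp : 1 < p) (hd : s * p < d)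
    {L : ℝ} (hL : 0 ≤ L) : ∫⁻ z : Euc d, truncKer s p L z < ∞ := by
  have hsp : 0 < s * p := by positivity
  have hd0 : (0 : ℝ) < d := by linarith
  have hd1 : 1 ≤ d := by exact_mod_cast hd0
  rw [← lintegral_add_compl _ (measurableSet_ball (x := (0 : Euc d)) (ε := 1))]
  refine ENNReal.add_lt_top.2 ⟨?_, ?_⟩
  · calc ∫⁻ z in Metric.ball (0 : Euc d) 1, truncKer s p L z
        ≤ ∫⁻ z in Metric.ball (0 : Euc d) 1, ENNReal.ofReal (L ^ p) *
            ENNReal.ofReal (‖z‖ ^ (-((d : ℝ) + s * p - p))) := by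
          refine lintegral_mono fun z ↦ ?_
          unfold truncKer
          rw [← ENNReal.ofReal_mul (by positivity)]
          refine ENNReal.ofReal_le_ofReal ?_
          rcases (norm_nonneg z).eq_or_lt with h0 | h0
          · rw [← h0, Real.zero_rpow (by linarith : (d : ℝ) + s * p ≠ 0)]
            simp only [div_zero]
            positivity
          · have : ‖z‖ ^ (-((d : ℝ) + s * p - p)) = ‖z‖ ^ p / ‖z‖ ^ ((d : ℝ) + s * p) := by
              rw [← Real.rpow_sub h0]; congr 1; ring
            rw [this, ← mul_div_assoc, ← Real.mul_rpow hL h0.le]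
            gcongr
            exact min_le_left _ _
      _ < ∞ := by
          rw [lintegral_const_mul' _ _ ENNReal.ofReal_ne_top]
          refine ENNReal.mul_lt_top ENNReal.ofReal_lt_top
            (lintegral_ball_norm_rpow_neg_lt_top hd1 ?_ 1)
          nlinarith
  · have hint := (integrable_one_add_norm (E := Euc d) (μ := volume) (r := (d : ℝ) + s * p)
      (by rw [finrank_euclideanSpace, Fintype.card_fin]; linarith)).2
    rw [hasFiniteIntegral_iff_ofReal (Eventually.of_forall fun x ↦ by positivity)] at hint
    calc ∫⁻ z in (Metric.ball (0 : Euc d) 1)ᶜ, truncKer s p L z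
        ≤ ∫⁻ z in (Metric.ball (0 : Euc d) 1)ᶜ, ENNReal.ofReal (2 ^ ((d : ℝ) + s * p)) *
            ENNReal.ofReal ((1 + ‖z‖) ^ (-((d : ℝ) + s * p))) := by
          refine setLIntegral_mono' measurableSet_ball.compl fun z hz ↦ ?_
          have hz1 : 1 ≤ ‖z‖ := by simpa using hz
          unfold truncKer
          rw [← ENNReal.ofReal_mul (by positivity)]
          refine ENNReal.ofReal_le_ofReal ?_
          rw [Real.rpow_neg (by positivity), ← div_eq_mul_inv,
            div_le_div_iff₀ (by positivity) (by positivity)]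
          have h1 : min (L * ‖z‖) 1 ^ p ≤ 1 :=
            Real.rpow_le_one (by positivity) (min_le_right _ _) (by linarith)
          calc min (L * ‖z‖) 1 ^ p * (1 + ‖z‖) ^ ((d : ℝ) + s * p)
              ≤ 1 * (2 * ‖z‖) ^ ((d : ℝ) + s * p) := by
                gcongr
                linarith
            _ = _ := by rw [one_mul, Real.mul_rpow (by norm_num) (by positivity)]
      _ ≤ ∫⁻ z : Euc d, ENNReal.ofReal (2 ^ ((d : ℝ) + s * p)) *
            ENNReal.ofReal ((1 + ‖z‖) ^ (-((d : ℝ) + s * p))) := setLIntegral_le_lintegral _ _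
      _ < ∞ := by
          rw [lintegral_const_mul' _ _ ENNReal.ofReal_ne_top]
          exact ENNReal.mul_lt_top ENNReal.ofReal_lt_top hint

lemma tendsto_lintegral_truncKer (hs0 : 0 < s) (hs1 : s < 1) (hp : 1 < p) (hd : s * p < d) :
    Tendsto (fun n : ℕ ↦ ∫⁻ z : Euc d, truncKer s p (1 / ((n : ℝ) + 1)) z) atTop (𝓝 0) := by
  have h := tendsto_lintegral_of_dominated_convergence
    (F := fun (n : ℕ) (z : Euc d) ↦ truncKer s p (1 / ((n : ℝ) + 1)) z) (f := fun _ ↦ 0)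
    (μ := volume) (truncKer s p 1) (fun n ↦ measurable_truncKer _) ?_
    (lintegral_truncKer_lt_top hs0 hs1 hp hd zero_le_one).ne ?_
  · simpa using h
  · refine fun n ↦ Eventually.of_forall fun z ↦ ?_
    have : 1 / ((n : ℝ) + 1) ≤ 1 := by
      rw [div_le_one (by positivity)]
      have : (0 : ℝ) ≤ n := n.cast_nonneg
      linarith
    simp only [truncKer]
    gcongr
  · refine Eventually.of_forall fun z ↦ ?_
    have h1 : Tendsto (fun n : ℕ ↦ min (1 / ((n : ℝ) + 1) * ‖z‖) 1) atTop (𝓝 (min (0 * ‖z‖) 1)) :=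
      (tendsto_one_div_add_atTop_nhds_zero_nat.mul_const _).min tendsto_const_nhds
    have h2 := ENNReal.tendsto_ofReal
      ((h1.rpow_const (p := p) (Or.inr (by linarith))).div_const (‖z‖ ^ ((d : ℝ) + s * p)))
    simpa [truncKer, Real.zero_rpow (by linarith : p ≠ 0)] using h2

lemma lintegral_mul_truncKer_fst {f : Euc d → ℝ≥0∞} (hf : AEMeasurable f) (L : ℝ) :
    ∫⁻ z : Euc d × Euc d, f z.1 * truncKer s p L (z.1 - z.2) =
      (∫⁻ x, f x) * ∫⁻ z : Euc d, truncKer s p L z := by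
  have hk : Measurable fun z : Euc d × Euc d ↦ truncKer s p L (z.1 - z.2) :=
    (measurable_truncKer L).comp (measurable_fst.sub measurable_snd)
  have hm : AEMeasurable (fun z : Euc d × Euc d ↦ f z.1 * truncKer s p L (z.1 - z.2))
      ((volume : Measure (Euc d)).prod volume) :=
    (hf.comp_quasiMeasurePreserving Measure.quasiMeasurePreserving_fst).mul hk.aemeasurable
  rw [Measure.volume_eq_prod, lintegral_prod _ hm, ← lintegral_mul_const'']
  · refine lintegral_congr fun x ↦ ?_
    have h1 : Measurable fun y : Euc d ↦ truncKer s p L (x - y) :=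
      (measurable_truncKer L).comp (measurable_const.sub measurable_id)
    simp only
    rw [lintegral_const_mul _ h1, lintegral_sub_left_eq_self (fun z ↦ truncKer s p L z) x]
  · exact hf

lemma lintegral_mul_truncKer_snd {f : Euc d → ℝ≥0∞} (hf : AEMeasurable f) (L : ℝ) :
    ∫⁻ z : Euc d × Euc d, f z.2 * truncKer s p L (z.1 - z.2) =
      (∫⁻ x, f x) * ∫⁻ z : Euc d, truncKer s p L z := by
  rw [← lintegral_mul_truncKer_fst hf, Measure.volume_eq_prod]
  rw [← lintegral_prod_swap]
  refine lintegral_congr fun z ↦ ?_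
  simp only [Prod.fst_swap, Prod.snd_swap]
  rw [← truncKer_neg, neg_sub]

end Kernel

/-! ### Tent functions and cut-off -/

section Tent

variable {d : ℕ} {s p : ℝ} {u : Euc d → ℝ}

/-- The tent function `max(0, 1 - |x - c| / R)`, supported in the ball of radius `R` around `c`. -/
def tent (c : Euc d) (R : ℝ) (x : Euc d) : ℝ := max 0 (1 - ‖x - c‖ / R)

lemma tent_nonneg (c : Euc d) (R : ℝ) (x : Euc d) : 0 ≤ tent c R x := le_max_left _ _

lemma tent_le_one (c : Euc d) {R : ℝ} (hR : 0 < R) (x : Euc d) : tent c R x ≤ 1 :=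
  max_le zero_le_one (by have : 0 ≤ ‖x - c‖ / R := by positivity
                         linarith)

lemma tent_pos {c : Euc d} {R : ℝ} (hR : 0 < R) {x : Euc d} (hx : x ∈ Metric.ball c R) :
    0 < tent c R x := by
  rw [mem_ball_iff_norm, ← div_lt_one hR] at hx
  exact lt_max_of_lt_right (by linarith)

lemma tent_eq_zero {c : Euc d} {R : ℝ} (hR : 0 < R) {x : Euc d} (hx : x ∉ Metric.ball c R) :
    tent c R x = 0 := by
  rw [mem_ball_iff_norm, not_lt, ← one_le_div hR] at hx
  exact max_eq_left (by linarith)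

lemma continuous_tent (c : Euc d) (R : ℝ) : Continuous (tent c R) := by
  unfold tent; fun_prop

lemma abs_tent_sub_le (c : Euc d) {R : ℝ} (hR : 0 < R) (x y : Euc d) :
    |tent c R x - tent c R y| ≤ min (1 / R * ‖x - y‖) 1 := by
  refine le_min ?_ ?_
  · unfold tent
    refine (abs_max_sub_max_le_max _ _ _ _).trans ?_
    rw [sub_self, abs_zero]
    refine max_le (by positivity) ?_
    have h1 : 1 - ‖x - c‖ / R - (1 - ‖y - c‖ / R) = 1 / R * (‖y - c‖ - ‖x - c‖) := by ring
    rw [h1, abs_mul, abs_of_pos (by positivity : 0 < 1 / R)]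
    gcongr
    refine (abs_norm_sub_norm_le _ _).trans ?_
    rw [sub_sub_sub_cancel_right, norm_sub_rev]
  · have := tent_nonneg c R x
    have := tent_nonneg c R y
    have := tent_le_one c hR x
    have := tent_le_one c hR y
    rw [abs_le]
    constructor <;> linarith

lemma gagDens_tent_le (hp : 0 ≤ p) (c : Euc d) {R : ℝ} (hR : 0 < R) (x y : Euc d) :
    gagDens s p (tent c R) x y ≤ truncKer s p (1 / R) (x - y) := by
  unfold gagDens truncKer
  have := abs_tent_sub_le c hR x y
  gcongr

lemma memD_tent (hs0 : 0 < s) (hs1 : s < 1) (hp : 1 < p) (hd : s * p < d) (c : Euc d) {R : ℝ}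
    (hR : 0 < R) : MemD s p (tent c R) := by
  have hr : 0 < critExp d s p 0 := by have := lt_critExp hs0 hp hd; linarith
  set B := Metric.ball c R with hB
  refine (memD_iff hs0 hp hd).2 ⟨(continuous_tent c R).measurable.aemeasurable, ?_, ?_⟩
  · calc powInt (critExp d s p 0) (tent c R)
        ≤ ∫⁻ x, B.indicator (fun _ ↦ 1) x := by
          refine lintegral_mono fun x ↦ ?_
          by_cases hx : x ∈ B
          · rw [Set.indicator_of_mem hx, ENNReal.ofReal_le_one, abs_of_nonneg (tent_nonneg _ _ _)]
            exact Real.rpow_le_one (tent_nonneg _ _ _) (tent_le_one c hR x) hr.le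
          · simp [tent_eq_zero hR hx, Real.zero_rpow hr.ne']
      _ < ∞ := by
          rw [lintegral_indicator measurableSet_ball, setLIntegral_one]
          exact measure_ball_lt_top
  · have hind : AEMeasurable (B.indicator (fun _ ↦ (1 : ℝ≥0∞))) :=
      (measurable_const.indicator measurableSet_ball).aemeasurable
    have hind1 : Measurable fun z : Euc d × Euc d ↦
        B.indicator (fun _ ↦ (1 : ℝ≥0∞)) z.1 * truncKer s p (1 / R) (z.1 - z.2) :=
      ((measurable_const.indicator measurableSet_ball).comp measurable_fst).mul
        ((measurable_truncKer _).comp (measurable_fst.sub measurable_snd))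
    have hfin : (∫⁻ x, B.indicator (fun _ ↦ (1 : ℝ≥0∞)) x) *
        ∫⁻ z : Euc d, truncKer s p (1 / R) z < ∞ := by
      rw [lintegral_indicator measurableSet_ball, setLIntegral_one]
      exact ENNReal.mul_lt_top measure_ball_lt_top
        (lintegral_truncKer_lt_top hs0 hs1 hp hd (by positivity))
    calc gagliardoPow s p (tent c R)
        ≤ ∫⁻ z : Euc d × Euc d, (B.indicator (fun _ ↦ (1 : ℝ≥0∞)) z.1 *
              truncKer s p (1 / R) (z.1 - z.2) +
            B.indicator (fun _ ↦ (1 : ℝ≥0∞)) z.2 * truncKer s p (1 / R) (z.1 - z.2)) := by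
          rw [gagliardoPow_eq_dens]
          refine lintegral_mono fun z ↦ ?_
          have h1 := gagDens_tent_le (s := s) (by linarith : 0 ≤ p) c hR z.1 z.2
          by_cases hx : z.1 ∈ B
          · rw [Set.indicator_of_mem hx, one_mul]
            exact h1.trans le_self_add
          · by_cases hy : z.2 ∈ B
            · rw [Set.indicator_of_mem hy, one_mul]
              exact h1.trans le_add_self
            · simp [gagDens, tent_eq_zero hR hx, tent_eq_zero hR hy,
                Real.zero_rpow (by linarith : p ≠ 0)]
      _ < ∞ := by
          rw [lintegral_add_left hind1, lintegral_mul_truncKer_fst hind,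
            lintegral_mul_truncKer_snd hind]
          exact ENNReal.add_lt_top.2 ⟨hfin, hfin⟩

/-- The cut-off estimate `[u τ] ≤ [u] + (‖u‖_p^p ∫ k)^(1/p)` for a tent function `τ`, where `k` is
the truncated kernel with Lipschitz constant `1 / R`. -/
lemma gagliardoPow_mul_tent_le (hp : 1 < p) (hu : AEMeasurable u) (c : Euc d) {R : ℝ} (hR : 0 < R) :
    gagliardoPow s p (fun x ↦ u x * tent c R x) ^ (1 / p) ≤ gagliardoPow s p u ^ (1 / p) +
      (powInt p u * ∫⁻ z : Euc d, truncKer s p (1 / R) z) ^ (1 / p) := by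
  have hp0 : 0 < p := by linarith
  set F : Euc d × Euc d → ℝ≥0∞ := fun z ↦ gagDens s p u z.1 z.2 ^ (1 / p)
  set G : Euc d × Euc d → ℝ≥0∞ := fun z ↦
    (ENNReal.ofReal (|u z.1| ^ p) * truncKer s p (1 / R) (z.1 - z.2)) ^ (1 / p)
  have hF : AEMeasurable F (volume.prod volume) := (aemeasurable_gagDens hu).pow_const _
  have hG : AEMeasurable G (volume.prod volume) := by
    have h1 : AEMeasurable (fun z : Euc d × Euc d ↦ ENNReal.ofReal (|u z.1| ^ p))
        ((volume : Measure (Euc d)).prod volume) :=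
      (aemeasurable_powInt hu).comp_quasiMeasurePreserving Measure.quasiMeasurePreserving_fst
    have h2 : Measurable fun z : Euc d × Euc d ↦ truncKer s p (1 / R) (z.1 - z.2) :=
      (measurable_truncKer (1 / R)).comp (measurable_fst.sub measurable_snd)
    exact (h1.mul h2.aemeasurable).pow_const _
  have hinv : ∀ x : ℝ≥0∞, (x ^ (1 / p)) ^ p = x := fun x ↦ by
    rw [← ENNReal.rpow_mul, one_div, inv_mul_cancel₀ hp0.ne', ENNReal.rpow_one]
  have h := ENNReal.lintegral_Lp_add_le hF hG hp.le
  have hFG : ∫⁻ z, F z ^ p ∂(volume.prod volume) = gagliardoPow s p u :=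
    lintegral_congr fun z ↦ hinv _
  have hGG : ∫⁻ z, G z ^ p ∂(volume.prod volume) =
      powInt p u * ∫⁻ z : Euc d, truncKer s p (1 / R) z := by
    rw [powInt, ← lintegral_mul_truncKer_fst (aemeasurable_powInt hu)]
    exact lintegral_congr fun z ↦ hinv _
  rw [hFG, hGG] at h
  refine le_trans ?_ h
  refine ENNReal.rpow_le_rpow (lintegral_mono fun z ↦ ?_) (by positivity)
  rw [← ENNReal.rpow_le_rpow_iff (z := 1 / p) (by positivity), ← ENNReal.rpow_mul _ p,
    mul_one_div_cancel hp0.ne', ENNReal.rpow_one]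
  set D := ‖z.1 - z.2‖ ^ ((d : ℝ) + s * p) with hD
  have hD0 : 0 ≤ D := by positivity
  have root : ∀ t : ℝ, 0 ≤ t → ENNReal.ofReal (t ^ p / D) ^ (1 / p) =
      ENNReal.ofReal (t / D ^ (1 / p)) := fun t ht ↦ by
    rw [ENNReal.ofReal_rpow_of_nonneg (by positivity) (by positivity),
      Real.div_rpow (by positivity) hD0, ← Real.rpow_mul ht, mul_one_div_cancel hp0.ne',
      Real.rpow_one]
  have hτ0 := tent_nonneg c R z.2
  have hτ1 := tent_le_one c hR z.2
  have hmin : 0 ≤ min (1 / R * ‖z.1 - z.2‖) 1 := by positivity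
  have e2 : G z = ENNReal.ofReal (|u z.1| * min (1 / R * ‖z.1 - z.2‖) 1 / D ^ (1 / p)) := by
    rw [← root _ (by positivity), Real.mul_rpow (abs_nonneg _) hmin, mul_div_assoc,
      ENNReal.ofReal_mul (by positivity)]
    rfl
  have e1 : F z = ENNReal.ofReal (|u z.1 - u z.2| / D ^ (1 / p)) := root _ (abs_nonneg _)
  simp only [Pi.add_apply]
  rw [e1, e2, root _ (abs_nonneg _), ← ENNReal.ofReal_add (by positivity) (by positivity),
    ← add_div]
  refine ENNReal.ofReal_le_ofReal ?_
  gcongr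
  have e3 : u z.1 * tent c R z.1 - u z.2 * tent c R z.2 =
      (u z.1 - u z.2) * tent c R z.2 + u z.1 * (tent c R z.1 - tent c R z.2) := by ring
  rw [e3]
  refine (abs_add_le _ _).trans ?_
  rw [abs_mul, abs_mul, abs_of_nonneg hτ0]
  have h3 := abs_tent_sub_le c hR z.1 z.2
  have h4 : |u z.1 - u z.2| * tent c R z.2 ≤ |u z.1 - u z.2| * 1 := by gcongr
  have h5 : |u z.1| * |tent c R z.1 - tent c R z.2| ≤
    |u z.1| * min (1 / R * ‖z.1 - z.2‖) 1 := by gcongr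
  linarith

end Tent

/-! ### Means over a grid of cubes -/

section Grid

variable {d : ℕ} {s p h : ℝ} {u : Euc d → ℝ}

/-- The index of the cube of side `h` that contains `x`. -/
def gridIdx (h : ℝ) (x : Euc d) : Fin d → ℤ := fun i ↦ ⌊x i / h⌋

/-- The half-open cube of side `h` with index `j`. -/
def gridCell (h : ℝ) (j : Fin d → ℤ) : Set (Euc d) := {x | gridIdx h x = j}

/-- The mean of `u` over the cube of side `h` with index `j`. -/
def cellMean (h : ℝ) (u : Euc d → ℝ) (j : Fin d → ℤ) : ℝ := (h ^ d)⁻¹ * ∫ y in gridCell h j, u y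

lemma measurable_gridIdx (h : ℝ) : Measurable (gridIdx (d := d) h) := by
  refine measurable_pi_lambda _ fun i ↦ ?_
  have : Measurable fun x : Euc d ↦ x i / h := by fun_prop
  exact Int.measurable_floor.comp this

lemma measurableSet_gridCell (h : ℝ) (j : Fin d → ℤ) : MeasurableSet (gridCell h j) :=
  measurable_gridIdx h (measurableSet_singleton j)

lemma volume_gridCell (hh : 0 < h) (j : Fin d → ℤ) :
    volume (gridCell h j) = ENNReal.ofReal (h ^ d) := by
  have h1 : gridCell h j = (WithLp.ofLp : Euc d → Fin d → ℝ) ⁻¹'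
      (Set.pi Set.univ fun i ↦ Set.Ico (j i * h) ((j i + 1) * h)) := by
    ext x
    simp only [gridCell, gridIdx, Set.mem_ofPred_eq, funext_iff, Int.floor_eq_iff, Set.mem_preimage,
      Set.mem_pi, Set.mem_univ, true_implies, Set.mem_Ico, le_div_iff₀ hh, div_lt_iff₀ hh]
  rw [h1, (PiLp.volume_preserving_ofLp (Fin d)).measure_preimage
    (MeasurableSet.univ_pi fun _ ↦ measurableSet_Ico).nullMeasurableSet, Real.volume_pi_Ico]
  have h2 : ∀ i, (j i + 1) * h - j i * h = h := fun i ↦ by ring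
  simp [h2, ENNReal.ofReal_pow hh.le]

lemma norm_sub_le_of_gridIdx_eq (hh : 0 < h) {x y : Euc d} (hxy : gridIdx h y = gridIdx h x) :
    ‖x - y‖ ≤ d * h := by
  have hi : ∀ i, |x i - y i| ≤ h := fun i ↦ by
    have h1 := Int.abs_sub_lt_one_of_floor_eq_floor (congrFun hxy i).symm
    rw [← sub_div, abs_div, abs_of_pos hh, div_lt_one hh] at h1
    exact h1.le
  rw [EuclideanSpace.norm_eq]
  refine Real.sqrt_le_iff.2 ⟨by positivity, ?_⟩
  calc ∑ i, ‖(x - y) i‖ ^ 2 ≤ ∑ _i : Fin d, h ^ 2 := by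
        refine Finset.sum_le_sum fun i _ ↦ ?_
        have : ‖(x - y) i‖ ≤ h := hi i
        gcongr
    _ = d * h ^ 2 := by simp
    _ ≤ (d * h) ^ 2 := by
        rw [mul_pow]
        gcongr
        rcases Nat.eq_zero_or_pos d with h0 | h0
        · simp [h0]
        · have : (1 : ℝ) ≤ d := by exact_mod_cast h0
          nlinarith

/-- The difference between `u` and its mean over the cube of side `h` is of order `h^s`, with a
factor controlled by the Gagliardo seminorm. -/
lemma abs_sub_cellMean_le (hs0 : 0 < s) (hp : 1 < p) (hh : 0 < h) (hu : Integrable u) (x : Euc d) :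
    ENNReal.ofReal |u x - cellMean h u (gridIdx h x)| ≤ ENNReal.ofReal (h ^ s) *
      (1 + ENNReal.ofReal ((d : ℝ) ^ ((d : ℝ) + s * p)) * ∫⁻ y, gagDens s p u x y) := by
  set Q := gridCell h (gridIdx h x) with hQ
  have hQm : MeasurableSet Q := measurableSet_gridCell h _
  have hQv : volume Q = ENNReal.ofReal (h ^ d) := volume_gridCell hh _
  have hQr : volume.real Q = h ^ d := by
    rw [Measure.real, hQv, ENNReal.toReal_ofReal (by positivity)]
  have hQf : volume Q ≠ ∞ := by rw [hQv]; exact ENNReal.ofReal_ne_top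
  have e1 : u x - cellMean h u (gridIdx h x) = (h ^ d)⁻¹ * ∫ y in Q, (u x - u y) := by
    rw [integral_sub (integrableOn_const (μ := volume) (C := u x) hQf (by simp)) hu.integrableOn,
      setIntegral_const, hQr,
      smul_eq_mul, mul_sub, ← mul_assoc, inv_mul_cancel₀ (by positivity), one_mul]
    rfl
  have hpt : ∀ y ∈ Q, ENNReal.ofReal |u x - u y| ≤ ENNReal.ofReal (h ^ s) +
      ENNReal.ofReal (h ^ (s + d)) *
        (ENNReal.ofReal ((d : ℝ) ^ ((d : ℝ) + s * p)) * gagDens s p u x y) := by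
    intro y hy
    rcases le_or_gt |u x - u y| (h ^ s) with hle | hgt
    · exact (ENNReal.ofReal_le_ofReal hle).trans le_self_add
    refine le_trans ?_ le_add_self
    unfold gagDens
    have hxy : x ≠ y := by
      rintro rfl
      have : 0 < h ^ s := by positivity
      simp at hgt
      linarith
    have hn : 0 < ‖x - y‖ := norm_pos_iff.2 (sub_ne_zero.2 hxy)
    have hnd := norm_sub_le_of_gridIdx_eq hh hy
    rw [← ENNReal.ofReal_mul (by positivity), ← ENNReal.ofReal_mul (by positivity)]
    refine ENNReal.ofReal_le_ofReal ?_
    set t := |u x - u y| with ht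
    have ht0 : 0 < t := lt_trans (by positivity) hgt
    -- for `t ≥ h^s` one has `t ≤ h^(s (1 - p)) t^p`
    have h1 : t ≤ h ^ (s * (1 - p)) * t ^ p := by
      have : t ^ p = t * t ^ (p - 1) := by
        rw [Real.rpow_sub ht0, Real.rpow_one]; field_simp
      have h2 : (h ^ s) ^ (p - 1) ≤ t ^ (p - 1) :=
        Real.rpow_le_rpow (by positivity) hgt.le (by linarith)
      have h3 : h ^ (s * (1 - p)) * (h ^ s) ^ (p - 1) = 1 := by
        rw [← Real.rpow_mul hh.le, ← Real.rpow_add hh]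
        ring_nf
        exact Real.rpow_zero h
      calc t = t * (h ^ (s * (1 - p)) * (h ^ s) ^ (p - 1)) := by rw [h3, mul_one]
        _ ≤ t * (h ^ (s * (1 - p)) * t ^ (p - 1)) := by gcongr
        _ = _ := by rw [this]; ring
    have hE : 0 ≤ (d : ℝ) + s * p := by positivity
    have h4 : ‖x - y‖ ^ ((d : ℝ) + s * p) ≤
        (d : ℝ) ^ ((d : ℝ) + s * p) * h ^ ((d : ℝ) + s * p) := by
      rw [← Real.mul_rpow (by positivity) hh.le]
      exact Real.rpow_le_rpow hn.le hnd hE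
    have h5 : h ^ (s + d) = h ^ (s * (1 - p)) * h ^ ((d : ℝ) + s * p) := by
      rw [← Real.rpow_add hh]; congr 1; ring
    set D := ‖x - y‖ ^ ((d : ℝ) + s * p) with hD
    have hD0 : 0 < D := by positivity
    calc t ≤ h ^ (s * (1 - p)) * t ^ p := h1
      _ = h ^ (s * (1 - p)) * (D * (t ^ p / D)) := by field_simp
      _ ≤ h ^ (s * (1 - p)) *
          (((d : ℝ) ^ ((d : ℝ) + s * p) * h ^ ((d : ℝ) + s * p)) * (t ^ p / D)) := by gcongr
      _ = _ := by rw [h5]; ring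
  have hint : ∫⁻ y in Q, ENNReal.ofReal |u x - u y| ≤ ENNReal.ofReal (h ^ s) *
      ENNReal.ofReal (h ^ d) + ENNReal.ofReal (h ^ (s + d)) *
        (ENNReal.ofReal ((d : ℝ) ^ ((d : ℝ) + s * p)) * ∫⁻ y, gagDens s p u x y) := by
    calc _ ≤ ∫⁻ y in Q, (ENNReal.ofReal (h ^ s) + ENNReal.ofReal (h ^ (s + d)) *
        (ENNReal.ofReal ((d : ℝ) ^ ((d : ℝ) + s * p)) * gagDens s p u x y)) :=
          setLIntegral_mono' hQm hpt
      _ ≤ _ := by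
          rw [lintegral_add_left measurable_const, setLIntegral_const, hQv,
            lintegral_const_mul' _ _ ENNReal.ofReal_ne_top,
            lintegral_const_mul' _ _ ENNReal.ofReal_ne_top]
          gcongr
          exact Measure.restrict_le_self
  have e2 : ENNReal.ofReal |u x - cellMean h u (gridIdx h x)| ≤
      ENNReal.ofReal (h ^ d)⁻¹ * ∫⁻ y in Q, ENNReal.ofReal |u x - u y| := by
    rw [e1, abs_mul, abs_of_pos (by positivity), ENNReal.ofReal_mul (by positivity)]
    gcongr
    have := enorm_integral_le_lintegral_enorm (μ := volume.restrict Q) (fun y ↦ u x - u y)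
    simpa only [Real.enorm_eq_ofReal_abs] using this
  refine e2.trans ?_
  have e3 : ENNReal.ofReal (h ^ d)⁻¹ * (ENNReal.ofReal (h ^ s) * ENNReal.ofReal (h ^ d)) =
      ENNReal.ofReal (h ^ s) := by
    rw [← ENNReal.ofReal_mul (by positivity), ← ENNReal.ofReal_mul (by positivity)]
    congr 1
    field_simp
  have e4 : ENNReal.ofReal (h ^ d)⁻¹ * ENNReal.ofReal (h ^ (s + d)) =
      ENNReal.ofReal (h ^ s) := by
    rw [← ENNReal.ofReal_mul (by positivity), Real.rpow_add hh, Real.rpow_natCast]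
    congr 1
    field_simp
  calc ENNReal.ofReal (h ^ d)⁻¹ * ∫⁻ y in Q, ENNReal.ofReal |u x - u y|
      ≤ ENNReal.ofReal (h ^ d)⁻¹ * (ENNReal.ofReal (h ^ s) * ENNReal.ofReal (h ^ d) +
        ENNReal.ofReal (h ^ (s + d)) *
        (ENNReal.ofReal ((d : ℝ) ^ ((d : ℝ) + s * p)) * ∫⁻ y, gagDens s p u x y)) := by gcongr
    _ = _ := by rw [mul_add, e3, ← mul_assoc _ _ (_ * _), e4, mul_add, mul_one]

lemma abs_cellMean_le (hh : 0 < h) (j : Fin d → ℤ) {M : ℝ} (hM : 0 ≤ M)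
    (hu : ∫⁻ x, ENNReal.ofReal |u x| ≤ ENNReal.ofReal M) : |cellMean h u j| ≤ (h ^ d)⁻¹ * M := by
  unfold cellMean
  rw [abs_mul, abs_of_pos (by positivity)]
  gcongr
  rw [← ENNReal.ofReal_le_ofReal_iff hM, ← Real.enorm_eq_ofReal_abs]
  refine (enorm_integral_le_lintegral_enorm _).trans (le_trans ?_ hu)
  simp only [Real.enorm_eq_ofReal_abs]
  exact setLIntegral_le_lintegral _ _

end Grid

/-! ### Compactness -/

section Compactness

variable {d : ℕ} {s p : ℝ}

lemma lintegral_abs_le {r R : ℝ} (hr : 1 ≤ r) {u : Euc d → ℝ}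
    (hsupp : ∀ᵐ x : Euc d, x ∉ Metric.ball (0 : Euc d) R → u x = 0) :
    ∫⁻ x, ENNReal.ofReal |u x| ≤ volume (Metric.ball (0 : Euc d) R) + powInt r u := by
  calc ∫⁻ x, ENNReal.ofReal |u x| ≤
      ∫⁻ x, ((Metric.ball (0 : Euc d) R).indicator (fun _ ↦ 1) x + ENNReal.ofReal (|u x| ^ r)) := by
        refine lintegral_mono_ae ?_
        filter_upwards [hsupp] with x hx
        by_cases hxB : x ∈ Metric.ball (0 : Euc d) R
        · rw [Set.indicator_of_mem hxB, ← ENNReal.ofReal_one,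
            ← ENNReal.ofReal_add zero_le_one (by positivity)]
          refine ENNReal.ofReal_le_ofReal ?_
          have h0 : 0 ≤ |u x| ^ r := by positivity
          rcases le_total |u x| 1 with h1 | h1
          · linarith
          · have := Real.self_le_rpow_of_one_le h1 hr
            linarith
        · simp [hx hxB]
    _ = _ := by
        rw [lintegral_add_left (measurable_const.indicator measurableSet_ball),
          lintegral_indicator measurableSet_ball, setLIntegral_one]
        rfl

/-- Rellich-type compactness: a sequence that is bounded in the Gagliardo seminorm and supported in
a fixed ball has a subsequence that converges almost everywhere. The means over the cubes of side `1
/ (k + 1)` live in a compact product, and `abs_sub_cellMean_le` makes the sequence uniformly close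
in `L¹` to its piecewise constant approximations. -/
theorem exists_subseq_tendsto_ae (hs0 : 0 < s) (hp : 1 < p) (hd : s * p < d)
    {f : ℕ → Euc d → ℝ} {R : ℝ} {M : ℝ≥0∞} (hM : M ≠ ∞) (hf : ∀ n, MemD s p (f n))
    (hsupp : ∀ n, ∀ᵐ x : Euc d, x ∉ Metric.ball (0 : Euc d) R → f n x = 0)
    (hg : ∀ n, gagliardoPow s p (f n) ≤ M) :
    ∃ (u : Euc d → ℝ) (φ : ℕ → ℕ), Measurable u ∧ StrictMono φ ∧
      ∀ᵐ x, Tendsto (fun n ↦ f (φ n) x) atTop (𝓝 (u x)) := by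
  have hr := lt_critExp hs0 hp hd
  set r := critExp d s p 0
  obtain ⟨C, hC, hS⟩ := exists_powInt_le hs0 hp hd
  set B := Metric.ball (0 : Euc d) R with hB
  have hae : ∀ n, AEMeasurable (f n) := fun n ↦ ((memD_iff hs0 hp hd).1 (hf n)).1
  have hexp : 0 ≤ (d : ℝ) / (d - s * p) := by
    have : 0 < s * p := by positivity
    apply div_nonneg <;> linarith
  -- a uniform bound in `L¹`
  set M' : ℝ≥0∞ := volume B + (ENNReal.ofReal C * M) ^ ((d : ℝ) / (d - s * p))
  have hM' : M' ≠ ∞ := by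
    refine ENNReal.add_ne_top.2 ⟨measure_ball_lt_top.ne, ?_⟩
    exact ENNReal.rpow_ne_top_of_nonneg hexp (ENNReal.mul_ne_top ENNReal.ofReal_ne_top hM)
  have hL1 : ∀ n, ∫⁻ x, ENNReal.ofReal |f n x| ≤ ENNReal.ofReal M'.toReal := fun n ↦ by
    rw [ENNReal.ofReal_toReal hM']
    refine (lintegral_abs_le (r := r) (by linarith) (hsupp n)).trans ?_
    refine add_le_add_right ((hS _ (hf n)).trans ?_) _
    gcongr
    exact hg n
  have hint : ∀ n, Integrable (f n) := fun n ↦ by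
    refine ⟨(hae n).aestronglyMeasurable, ?_⟩
    rw [hasFiniteIntegral_iff_enorm]
    simp only [Real.enorm_eq_ofReal_abs]
    exact (hL1 n).trans_lt ENNReal.ofReal_lt_top
  -- a subsequence along which all means over cubes of side `1 / (k + 1)` converge
  set h : ℕ → ℝ := fun k ↦ 1 / ((k : ℝ) + 1) with hh_def
  have hh : ∀ k, 0 < h k := fun k ↦ by positivity
  obtain ⟨a, -, φ, hφ, hlim⟩ := (isCompact_univ_pi (X := fun _ : ℕ × (Fin d → ℤ) ↦ ℝ)
    (s := fun kj ↦ Set.Icc (-((h kj.1 ^ d)⁻¹ * M'.toReal)) ((h kj.1 ^ d)⁻¹ * M'.toReal))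
    fun _ ↦ isCompact_Icc).tendsto_subseq
    (x := fun n kj ↦ cellMean (h kj.1) (f n) kj.2)
    (fun n kj _ ↦ by
      have := abs_cellMean_le (hh kj.1) kj.2 ENNReal.toReal_nonneg (hL1 n)
      exact ⟨(abs_le.1 this).1, (abs_le.1 this).2⟩)
  rw [tendsto_pi_nhds] at hlim
  set g : ℕ → Euc d → ℝ := fun n ↦ f (φ n) with hg_def
  -- the distance to the piecewise constant approximation
  set E : ℝ≥0∞ := volume B + ENNReal.ofReal ((d : ℝ) ^ ((d : ℝ) + s * p)) * M with hE_def
  have hE : E ≠ ∞ := ENNReal.add_ne_top.2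
    ⟨measure_ball_lt_top.ne, ENNReal.mul_ne_top ENNReal.ofReal_ne_top hM⟩
  have happrox : ∀ k n, ∫⁻ x in B, ENNReal.ofReal |g n x - cellMean (h k) (g n) (gridIdx (h k) x)| ≤
      ENNReal.ofReal (h k ^ s) * E := by
    intro k n
    calc _ ≤ ∫⁻ x in B, ENNReal.ofReal (h k ^ s) *
          (1 + ENNReal.ofReal ((d : ℝ) ^ ((d : ℝ) + s * p)) * ∫⁻ y, gagDens s p (g n) x y) :=
          lintegral_mono fun x ↦ abs_sub_cellMean_le hs0 hp (hh k) (hint _) x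
      _ ≤ _ := by
          rw [lintegral_const_mul' _ _ ENNReal.ofReal_ne_top, lintegral_add_left measurable_const,
            setLIntegral_one, lintegral_const_mul' _ _ ENNReal.ofReal_ne_top]
          have h1 : ∫⁻ x in B, ∫⁻ y, gagDens s p (g n) x y ≤ M :=
            (setLIntegral_le_lintegral _ _).trans
              ((gagliardoPow_eq_iterated (hae _)).symm.le.trans (hg _))
          rw [hE_def]
          gcongr
  have hmeasP : ∀ (k : ℕ) (b : (Fin d → ℤ) → ℝ), Measurable fun x : Euc d ↦ b (gridIdx (h k) x) :=
    fun k b ↦ (measurable_of_countable b).comp (measurable_gridIdx _)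
  have hconv : ∀ k, Tendsto (fun n ↦ ∫⁻ x in B, ENNReal.ofReal
      |cellMean (h k) (g n) (gridIdx (h k) x) - a (k, gridIdx (h k) x)|) atTop (𝓝 0) := by
    intro k
    have hb : ∀ n j, |cellMean (h k) (g n) j| ≤ (h k ^ d)⁻¹ * M'.toReal := fun n j ↦
      abs_cellMean_le (hh k) j ENNReal.toReal_nonneg (hL1 _)
    have ha : ∀ j, |a (k, j)| ≤ (h k ^ d)⁻¹ * M'.toReal := fun j ↦
      le_of_tendsto (hlim (k, j)).abs (Eventually.of_forall fun n ↦ hb n j)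
    have := tendsto_lintegral_of_dominated_convergence (μ := volume.restrict B)
      (F := fun n x ↦ ENNReal.ofReal
        |cellMean (h k) (g n) (gridIdx (h k) x) - a (k, gridIdx (h k) x)|) (f := fun _ ↦ 0)
      (fun _ ↦ ENNReal.ofReal (2 * ((h k ^ d)⁻¹ * M'.toReal)))
      (fun n ↦ ENNReal.measurable_ofReal.comp (continuous_abs.measurable.comp
        ((hmeasP k _).sub (hmeasP k fun j ↦ a (k, j)))))
      (fun n ↦ Eventually.of_forall fun x ↦ ENNReal.ofReal_le_ofReal (by
        refine (abs_sub _ _).trans ?_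
        have := hb n (gridIdx (h k) x)
        have := ha (gridIdx (h k) x)
        linarith))
      (by
        rw [setLIntegral_const]
        exact ENNReal.mul_ne_top ENNReal.ofReal_ne_top measure_ball_lt_top.ne)
      (Eventually.of_forall fun x ↦ by
        have h1 := ((hlim (k, gridIdx (h k) x)).sub_const (a (k, gridIdx (h k) x))).abs
        simpa using ENNReal.tendsto_ofReal h1)
    simpa using this
  have hsmall : Tendsto (fun k ↦ ENNReal.ofReal (h k ^ s) * E) atTop (𝓝 0) := by
    have h1 : Tendsto (fun k ↦ h k ^ s) atTop (𝓝 0) := by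
      have := (tendsto_one_div_add_atTop_nhds_zero_nat (𝕜 := ℝ)).rpow_const (p := s)
        (Or.inr hs0.le)
      rwa [Real.zero_rpow hs0.ne'] at this
    have h2 := ENNReal.Tendsto.mul_const (ENNReal.tendsto_ofReal h1) (Or.inr hE)
    simpa using h2
  -- the subsequence is Cauchy in `L¹`
  have hcau : CauchySeq fun n ↦ (hint (φ n)).toL1 (g n) := by
    rw [EMetric.cauchySeq_iff]
    intro ε hε
    have hε4 : 0 < ε / 4 := ENNReal.div_pos hε.ne' (by norm_num)
    obtain ⟨k, hk⟩ := (hsmall.eventually_lt_const hε4).exists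
    obtain ⟨n₀, hn₀⟩ := eventually_atTop.1 ((hconv k).eventually_lt_const hε4)
    refine ⟨n₀, fun m hm n hn ↦ ?_⟩
    rw [Integrable.edist_toL1_toL1]
    have hout : ∫⁻ x, edist (g m x) (g n x) = ∫⁻ x in B, edist (g m x) (g n x) := by
      rw [← lintegral_indicator measurableSet_ball]
      refine lintegral_congr_ae ?_
      filter_upwards [hsupp (φ m), hsupp (φ n)] with x h1 h2
      by_cases hx : x ∈ B
      · rw [Set.indicator_of_mem hx]
      · rw [Set.indicator_of_notMem hx, show g m x = 0 from h1 hx, show g n x = 0 from h2 hx,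
            edist_self]
    rw [hout]
    set P : ℕ → Euc d → ℝ := fun n x ↦ cellMean (h k) (g n) (gridIdx (h k) x) with hP
    set A : Euc d → ℝ := fun x ↦ a (k, gridIdx (h k) x) with hA
    have hPm : ∀ n, Measurable (P n) := fun n ↦ hmeasP k _
    have hAm : Measurable A := hmeasP k fun j ↦ a (k, j)
    have m1 : ∀ n, AEMeasurable (fun x ↦ ENNReal.ofReal |g n x - P n x|) (volume.restrict B) :=
      fun n ↦ ENNReal.measurable_ofReal.comp_aemeasurable (continuous_abs.measurable.comp_aemeasurable
        ((hae _).restrict.sub (hPm n).aemeasurable))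
    have m2 : ∀ n, AEMeasurable (fun x ↦ ENNReal.ofReal |P n x - A x|) (volume.restrict B) :=
      fun n ↦ ENNReal.measurable_ofReal.comp_aemeasurable (continuous_abs.measurable.comp_aemeasurable
        ((hPm n).aemeasurable.sub hAm.aemeasurable))
    calc ∫⁻ x in B, edist (g m x) (g n x)
        ≤ ∫⁻ x in B, ((ENNReal.ofReal |g m x - P m x| + ENNReal.ofReal |P m x - A x|) +
            (ENNReal.ofReal |g n x - P n x| + ENNReal.ofReal |P n x - A x|)) := by
          refine lintegral_mono fun x ↦ ?_
          rw [edist_dist, Real.dist_eq, ← ENNReal.ofReal_add (by positivity) (by positivity),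
            ← ENNReal.ofReal_add (by positivity) (by positivity),
            ← ENNReal.ofReal_add (by positivity) (by positivity)]
          refine ENNReal.ofReal_le_ofReal ?_
          have e1 := abs_sub_le (g m x) (A x) (g n x)
          have e2 := abs_sub_le (g m x) (P m x) (A x)
          have e3 := abs_sub_le (g n x) (P n x) (A x)
          rw [abs_sub_comm (A x) (g n x)] at e1
          linarith
      _ = (∫⁻ x in B, ENNReal.ofReal |g m x - P m x|) + (∫⁻ x in B, ENNReal.ofReal |P m x - A x|) +
          ((∫⁻ x in B, ENNReal.ofReal |g n x - P n x|) +
            (∫⁻ x in B, ENNReal.ofReal |P n x - A x|)) := by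
          have m3 : AEMeasurable (fun x ↦ ENNReal.ofReal |g m x - P m x| +
              ENNReal.ofReal |P m x - A x|) (volume.restrict B) := (m1 m).add (m2 m)
          rw [lintegral_add_left' m3, lintegral_add_left' (m1 m), lintegral_add_left' (m1 n)]
      _ < ε / 4 + ε / 4 + (ε / 4 + ε / 4) :=
          ENNReal.add_lt_add (ENNReal.add_lt_add ((happrox k m).trans_lt hk) (hn₀ m hm))
            (ENNReal.add_lt_add ((happrox k n).trans_lt hk) (hn₀ n hn))
      _ = ε := by
          have h4 : (4 : ℝ≥0∞) = 2 * 2 := by norm_num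
          have h1 : ε / 4 + ε / 4 = ε / 2 := by
            rw [← ENNReal.add_div, h4, ← two_mul]
            exact ENNReal.mul_div_mul_left _ _ two_ne_zero ENNReal.ofNat_ne_top
          rw [h1, ENNReal.add_halves]
  obtain ⟨G, hG⟩ := cauchySeq_tendsto_of_complete hcau
  obtain ⟨ψ, hψ, hψlim⟩ := (tendstoInMeasure_of_tendsto_Lp hG).exists_seq_tendsto_ae
  refine ⟨G, φ ∘ ψ, (Lp.stronglyMeasurable G).measurable, hφ.comp hψ, ?_⟩
  have hcoe : ∀ᵐ x, ∀ n, (hint (φ n)).toL1 (g n) x = g n x :=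
    ae_all_iff.2 fun n ↦ Integrable.coeFn_toL1 (hint (φ n))
  filter_upwards [hψlim, hcoe] with x hx hx'
  refine hx.congr fun n ↦ ?_
  exact hx' (ψ n)

end Compactness

/-! ### Passage to the limit in integrals -/

section Limit

variable {X : Type*} [MeasurableSpace X] {μ : Measure X}

/-- Vitali-type limit passage: on a finite measure space, a bound on `∫ F_n^θ` with `θ > 1` excludes
concentration, so that no mass is lost in the almost everywhere limit. -/
lemma le_lintegral_of_tendsto_of_rpow_bound [IsFiniteMeasure μ] {F : ℕ → X → ℝ≥0∞}
    {F₀ : X → ℝ≥0∞} {θ : ℝ} (hθ : 1 < θ) {M c : ℝ≥0∞} (hM : M ≠ ∞)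
    (hF : ∀ n, AEMeasurable (F n) μ) (hlim : ∀ᵐ x ∂μ, Tendsto (fun n ↦ F n x) atTop (𝓝 (F₀ x)))
    (hbound : ∀ n, ∫⁻ x, F n x ^ θ ∂μ ≤ M) (hc : ∀ n, c ≤ ∫⁻ x, F n x ∂μ) :
    c ≤ ∫⁻ x, F₀ x ∂μ := by
  have key : ∀ T : ℕ, c ≤ ∫⁻ x, F₀ x ∂μ + ENNReal.ofReal (((T : ℝ) + 1) ^ (1 - θ)) * M := by
    intro T
    set t : ℝ := (T : ℝ) + 1 with ht_def
    have ht : 0 < t := by positivity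
    have hpt : ∀ y : ℝ≥0∞, y ≤ min y (ENNReal.ofReal t) + ENNReal.ofReal (t ^ (1 - θ)) * y ^ θ := by
      intro y
      rcases le_or_gt y (ENNReal.ofReal t) with h | h
      · rw [min_eq_left h]; exact le_self_add
      · refine le_trans ?_ le_add_self
        rcases eq_or_ne y ∞ with rfl | hy
        · rw [ENNReal.top_rpow_of_pos (by linarith), ENNReal.mul_top]
          simp only [ne_eq, ENNReal.ofReal_eq_zero, not_le]
          positivity
        · lift y to NNReal using hy
          have hy' : t < (y : ℝ) := by
            rw [← ENNReal.ofReal_coe_nnreal] at h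
            exact (ENNReal.ofReal_lt_ofReal_iff_of_nonneg ht.le).1 h
          have hy0 : 0 < (y : ℝ) := ht.trans hy'
          rw [← ENNReal.ofReal_coe_nnreal, ENNReal.ofReal_rpow_of_pos hy0,
            ← ENNReal.ofReal_mul (by positivity)]
          refine ENNReal.ofReal_le_ofReal ?_
          have h1 : (y : ℝ) ^ (1 - θ) ≤ t ^ (1 - θ) :=
            Real.rpow_le_rpow_of_nonpos ht hy'.le (by linarith)
          calc (y : ℝ) = (y : ℝ) ^ (1 - θ) * (y : ℝ) ^ θ := by
                rw [← Real.rpow_add hy0]; simp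
            _ ≤ _ := by gcongr
    have hlimT : Tendsto (fun n ↦ ∫⁻ x, min (F n x) (ENNReal.ofReal t) ∂μ) atTop
        (𝓝 (∫⁻ x, min (F₀ x) (ENNReal.ofReal t) ∂μ)) := by
      refine tendsto_lintegral_of_dominated_convergence' (fun _ ↦ ENNReal.ofReal t)
        (fun n ↦ (hF n).min aemeasurable_const)
        (fun n ↦ Eventually.of_forall fun x ↦ min_le_right _ _) ?_ ?_
      · rw [lintegral_const]
        exact ENNReal.mul_ne_top ENNReal.ofReal_ne_top (measure_ne_top _ _)
      · filter_upwards [hlim] with x hx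
        exact hx.min tendsto_const_nhds
    have h1 : ∀ n, c ≤ ∫⁻ x, min (F n x) (ENNReal.ofReal t) ∂μ +
        ENNReal.ofReal (t ^ (1 - θ)) * M := by
      intro n
      calc c ≤ ∫⁻ x, F n x ∂μ := hc n
        _ ≤ ∫⁻ x, (min (F n x) (ENNReal.ofReal t) +
            ENNReal.ofReal (t ^ (1 - θ)) * F n x ^ θ) ∂μ := lintegral_mono fun x ↦ hpt _
        _ = ∫⁻ x, min (F n x) (ENNReal.ofReal t) ∂μ +
            ENNReal.ofReal (t ^ (1 - θ)) * ∫⁻ x, F n x ^ θ ∂μ := by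
            rw [lintegral_add_left' ((hF n).min aemeasurable_const),
              lintegral_const_mul' _ _ ENNReal.ofReal_ne_top]
        _ ≤ _ := by gcongr; exact hbound n
    calc c ≤ ∫⁻ x, min (F₀ x) (ENNReal.ofReal t) ∂μ + ENNReal.ofReal (t ^ (1 - θ)) * M :=
          ge_of_tendsto' (hlimT.add tendsto_const_nhds) h1
      _ ≤ _ := by
          gcongr with x
          exact min_le_left _ _
  have h2 : Tendsto (fun T : ℕ ↦ ∫⁻ x, F₀ x ∂μ + ENNReal.ofReal (((T : ℝ) + 1) ^ (1 - θ)) * M) atTop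
      (𝓝 (∫⁻ x, F₀ x ∂μ + 0 * M)) := by
    refine tendsto_const_nhds.add (ENNReal.Tendsto.mul_const ?_ (Or.inr hM))
    rw [← ENNReal.ofReal_zero]
    refine ENNReal.tendsto_ofReal ?_
    have h3 := (tendsto_rpow_neg_atTop (y := θ - 1) (by linarith)).comp
      (tendsto_atTop_add_const_right _ (1 : ℝ) tendsto_natCast_atTop_atTop)
    refine h3.congr fun T ↦ ?_
    simp only [Function.comp, neg_sub]
  rw [zero_mul, add_zero] at h2
  exact ge_of_tendsto' h2 key

end Limit

/-! ### The coupling integral -/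

section Coupling

variable {d : ℕ} {s p m α β : ℝ} {Ω : Set (Euc d)} {u v : Euc d → ℝ}

/-- The density `|u|^α |v|^β / |x|^m` of the coupling integral. -/
def couplingDens (m α β : ℝ) (u v : Euc d → ℝ) (x : Euc d) : ℝ≥0∞ :=
  ENNReal.ofReal (|u x| ^ α * |v x| ^ β / ‖x‖ ^ m)

lemma aemeasurable_couplingDens (hu : AEMeasurable u) (hv : AEMeasurable v) :
    AEMeasurable (couplingDens m α β u v) := by
  have h1 := (continuous_abs.measurable.comp_aemeasurable hu).pow_const α
  have h2 := (continuous_abs.measurable.comp_aemeasurable hv).pow_const β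
  exact ENNReal.measurable_ofReal.comp_aemeasurable
    ((h1.mul h2).div (measurable_norm.pow_const m).aemeasurable)

lemma coupling_mono (hα : 0 ≤ α) (hβ : 0 ≤ β) {u' v' : Euc d → ℝ} (hu : ∀ x, |u x| ≤ |u' x|)
    (hv : ∀ x, |v x| ≤ |v' x|) : coupling m α β Ω u v ≤ coupling m α β Ω u' v' := by
  refine lintegral_mono fun x ↦ ENNReal.ofReal_le_ofReal ?_
  have := hu x
  have := hv x
  gcongr

lemma coupling_const_mul (t : ℝ) : coupling m α β Ω (fun x ↦ t * u x) (fun x ↦ t * v x) =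
    ENNReal.ofReal (|t| ^ α * |t| ^ β) * coupling m α β Ω u v := by
  unfold coupling
  rw [← lintegral_const_mul' _ _ ENNReal.ofReal_ne_top]
  refine lintegral_congr fun x ↦ ?_
  rw [← ENNReal.ofReal_mul (by positivity), abs_mul, abs_mul,
    Real.mul_rpow (abs_nonneg _) (abs_nonneg _), Real.mul_rpow (abs_nonneg _) (abs_nonneg _)]
  congr 1
  ring

lemma coupling_eq_zero_left (hα : 0 < α) (hu : u =ᵐ[volume] 0) : coupling m α β Ω u v = 0 := by
  unfold coupling
  rw [← lintegral_zero (μ := volume.restrict Ω)]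
  refine lintegral_congr_ae (ae_restrict_of_ae ?_)
  filter_upwards [hu] with x hx
  simp [hx, Real.zero_rpow hα.ne']

lemma coupling_eq_zero_right (hβ : 0 < β) (hv : v =ᵐ[volume] 0) : coupling m α β Ω u v = 0 := by
  unfold coupling
  rw [← lintegral_zero (μ := volume.restrict Ω)]
  refine lintegral_congr_ae (ae_restrict_of_ae ?_)
  filter_upwards [hv] with x hx
  simp [hx, Real.zero_rpow hβ.ne']

lemma rpow_mul_rpow_le_max {a b : ℝ} (hα : 0 < α) (hβ : 0 < β) (ha : 0 ≤ a) (hb : 0 ≤ b) :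
    a ^ α * b ^ β ≤ max a b ^ (α + β) := by
  rw [Real.rpow_add_of_nonneg (ha.trans (le_max_left _ _)) hα.le hβ.le]
  gcongr
  · exact le_max_left _ _
  · exact le_max_right _ _

lemma max_rpow_le {a b r : ℝ} (ha : 0 ≤ a) (hb : 0 ≤ b) : max a b ^ r ≤ a ^ r + b ^ r := by
  have h1 : 0 ≤ a ^ r := by positivity
  have h2 : 0 ≤ b ^ r := by positivity
  rcases max_cases a b with ⟨h, -⟩ | ⟨h, -⟩ <;> rw [h] <;> linarith

/-- Subcritical integrability: below the critical exponent, some power `θ > 1` of the coupling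
density is controlled by `|u|^{p*_s} + |v|^{p*_s}` and a locally integrable power of `|x|`. The
condition on `θ` is `q θ / p*_s + m θ / d < 1`. -/
lemma exists_rpow_couplingDens_le (hs0 : 0 < s) (hp : 1 < p) (hd : s * p < d) (hm : 0 ≤ m)
    (hα : 1 < α) (hβ : 1 < β) (hq : α + β < critExp d s p m) :
    ∃ θ γ : ℝ, 1 < θ ∧ γ < d ∧ ∀ (u v : Euc d → ℝ) (x : Euc d), couplingDens m α β u v x ^ θ ≤
      ENNReal.ofReal (|u x| ^ critExp d s p 0) + ENNReal.ofReal (|v x| ^ critExp d s p 0) +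
        ENNReal.ofReal (‖x‖ ^ (-γ)) := by
  have hsp : 0 < s * p := by positivity
  have hd0 : (0 : ℝ) < d := by linarith
  have hds : 0 < (d : ℝ) - s * p := by linarith
  have hr0 : 0 < critExp d s p 0 := by have := lt_critExp hs0 hp hd; linarith
  have hrm : critExp d s p m = critExp d s p 0 * (d - m) / d := by
    unfold critExp; field_simp; ring
  set r := critExp d s p 0
  set q := α + β with hq_def
  have hq0 : 0 < q := by linarith
  have hlt : m * r + q * d < d * r := by
    rw [hrm, lt_div_iff₀ hd0] at hq
    linarith
  have hA : 0 < m * r + q * d := by positivity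
  obtain ⟨θ, hθ1, hθ2⟩ := exists_between ((one_lt_div hA).2 hlt)
  rw [lt_div_iff₀ hA] at hθ2
  have hθ0 : 0 < θ := by linarith
  have hqθ : q * θ < r := by
    have : 0 ≤ θ * (m * r) := by positivity
    nlinarith
  have hrq : 0 < r - q * θ := by linarith
  refine ⟨θ, m * θ * (r / (r - q * θ)), hθ1, ?_, fun u v x ↦ ?_⟩
  · rw [← mul_div_assoc, div_lt_iff₀ hrq]
    linarith
  have hconj : (r / (q * θ)).HolderConjugate (r / (r - q * θ)) := by
    rw [Real.holderConjugate_iff]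
    refine ⟨(one_lt_div (by positivity)).2 hqθ, ?_⟩
    field_simp
    ring
  set W := max |u x| |v x| with hW
  have hW0 : 0 ≤ W := (abs_nonneg _).trans (le_max_left _ _)
  have hreal : (|u x| ^ α * |v x| ^ β / ‖x‖ ^ m) ^ θ ≤
      |u x| ^ r + |v x| ^ r + ‖x‖ ^ (-(m * θ * (r / (r - q * θ)))) := by
    calc (|u x| ^ α * |v x| ^ β / ‖x‖ ^ m) ^ θ ≤ (W ^ q / ‖x‖ ^ m) ^ θ := by
          gcongr
          exact rpow_mul_rpow_le_max (by linarith) (by linarith) (abs_nonneg _) (abs_nonneg _)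
      _ = W ^ (q * θ) * ‖x‖ ^ (-(m * θ)) := by
          rw [Real.div_rpow (by positivity) (by positivity), ← Real.rpow_mul hW0,
            ← Real.rpow_mul (norm_nonneg _), Real.rpow_neg (norm_nonneg _), div_eq_mul_inv]
      _ ≤ (W ^ (q * θ)) ^ (r / (q * θ)) / (r / (q * θ)) +
          (‖x‖ ^ (-(m * θ))) ^ (r / (r - q * θ)) / (r / (r - q * θ)) :=
          Real.young_inequality_of_nonneg (by positivity) (by positivity) hconj
      _ ≤ (W ^ (q * θ)) ^ (r / (q * θ)) + (‖x‖ ^ (-(m * θ))) ^ (r / (r - q * θ)) :=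
          add_le_add (div_le_self (by positivity) hconj.lt.le)
            (div_le_self (by positivity) hconj.symm.lt.le)
      _ = W ^ r + ‖x‖ ^ (-(m * θ * (r / (r - q * θ)))) := by
          rw [← Real.rpow_mul hW0, ← Real.rpow_mul (norm_nonneg _), mul_div_cancel₀ _ (by positivity),
            neg_mul]
      _ ≤ _ := by
          gcongr
          exact max_rpow_le (abs_nonneg _) (abs_nonneg _)
  unfold couplingDens
  rw [ENNReal.ofReal_rpow_of_nonneg (by positivity) hθ0.le, ← ENNReal.ofReal_add (by positivity)
    (by positivity), ← ENNReal.ofReal_add (by positivity) (by positivity)]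
  exact ENNReal.ofReal_le_ofReal hreal

/-- On a bounded set, in the subcritical case, the integral of some power `θ > 1` of the coupling
density is bounded in terms of the `L^{p*_s}` modulars. -/
lemma exists_lintegral_rpow_couplingDens_le (hs0 : 0 < s) (hp : 1 < p) (hd : s * p < d)
    (hm : 0 ≤ m) (hα : 1 < α) (hβ : 1 < β) (hq : α + β < critExp d s p m)
    (hΩb : Bornology.IsBounded Ω) :
    ∃ (θ : ℝ) (M : ℝ≥0∞), 1 < θ ∧ M ≠ ∞ ∧ ∀ u v : Euc d → ℝ, AEMeasurable u → AEMeasurable v →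
      ∫⁻ x in Ω, couplingDens m α β u v x ^ θ ≤
        powInt (critExp d s p 0) u + powInt (critExp d s p 0) v + M := by
  obtain ⟨θ, γ, hθ, hγ, h⟩ := exists_rpow_couplingDens_le hs0 hp hd hm hα hβ hq
  have hsp : 0 < s * p := by positivity
  have hd1 : 1 ≤ d := by
    have : (0 : ℝ) < d := by linarith
    exact_mod_cast this
  obtain ⟨R, hR⟩ := hΩb.subset_ball (0 : Euc d)
  refine ⟨θ, ∫⁻ x in Metric.ball (0 : Euc d) R, ENNReal.ofReal (‖x‖ ^ (-γ)), hθ,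
    (lintegral_ball_norm_rpow_neg_lt_top hd1 hγ R).ne, fun u v hu hv ↦ ?_⟩
  calc ∫⁻ x in Ω, couplingDens m α β u v x ^ θ
      ≤ ∫⁻ x in Ω, (ENNReal.ofReal (|u x| ^ critExp d s p 0) +
          ENNReal.ofReal (|v x| ^ critExp d s p 0) + ENNReal.ofReal (‖x‖ ^ (-γ))) :=
        lintegral_mono fun x ↦ h u v x
    _ = (∫⁻ x in Ω, ENNReal.ofReal (|u x| ^ critExp d s p 0)) +
          (∫⁻ x in Ω, ENNReal.ofReal (|v x| ^ critExp d s p 0)) +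
          ∫⁻ x in Ω, ENNReal.ofReal (‖x‖ ^ (-γ)) := by
        have h1 : AEMeasurable (fun x ↦ ENNReal.ofReal (|u x| ^ critExp d s p 0))
          (volume.restrict Ω) := (aemeasurable_powInt hu).restrict
        have h2 : AEMeasurable (fun x ↦ ENNReal.ofReal (|v x| ^ critExp d s p 0))
          (volume.restrict Ω) := (aemeasurable_powInt hv).restrict
        have h3 : AEMeasurable (fun x ↦ ENNReal.ofReal (|u x| ^ critExp d s p 0) +
          ENNReal.ofReal (|v x| ^ critExp d s p 0)) (volume.restrict Ω) := h1.add h2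
        rw [lintegral_add_left' h3, lintegral_add_left' h1]
    _ ≤ _ := by
        gcongr
        · exact setLIntegral_le_lintegral _ _
        · exact setLIntegral_le_lintegral _ _

lemma coupling_lt_top_of_subcritical (hs0 : 0 < s) (hp : 1 < p) (hd : s * p < d)
    (hm : 0 ≤ m) (hα : 1 < α) (hβ : 1 < β) (hq : α + β < critExp d s p m)
    (hΩb : Bornology.IsBounded Ω) (hu : MemD s p u) (hv : MemD s p v) :
    coupling m α β Ω u v < ∞ := by
  obtain ⟨θ, M, hθ, hM, h⟩ :=
    exists_lintegral_rpow_couplingDens_le hs0 hp hd hm hα hβ hq hΩb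
  obtain ⟨hu1, hu2, -⟩ := (memD_iff hs0 hp hd).1 hu
  obtain ⟨hv1, hv2, -⟩ := (memD_iff hs0 hp hd).1 hv
  have hb : ∫⁻ x in Ω, couplingDens m α β u v x ^ θ < ∞ :=
    (h u v hu1 hv1).trans_lt
      (ENNReal.add_lt_top.2 ⟨ENNReal.add_lt_top.2 ⟨hu2, hv2⟩, hM.lt_top⟩)
  calc coupling m α β Ω u v ≤ ∫⁻ x in Ω, (1 + couplingDens m α β u v x ^ θ) := by
        refine lintegral_mono fun x ↦ ?_
        change couplingDens m α β u v x ≤ _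
        rcases le_total (couplingDens m α β u v x) 1 with h1 | h1
        · exact h1.trans le_self_add
        · refine le_trans ?_ le_add_self
          calc couplingDens m α β u v x = couplingDens m α β u v x ^ (1 : ℝ) := by simp
            _ ≤ _ := ENNReal.rpow_le_rpow_of_exponent_le h1 hθ.le
    _ < ∞ := by
        rw [lintegral_add_left measurable_const, setLIntegral_one]
        exact ENNReal.add_lt_top.2 ⟨hΩb.measure_lt_top, hb⟩

/-- In the critical case the coupling integral is at most the sum of the `L^{p*_s}` modulars. -/
lemma coupling_lt_top_of_critical (hs0 : 0 < s) (hp : 1 < p) (hd : s * p < d)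
    (hα : 1 < α) (hβ : 1 < β) (hq : α + β = critExp d s p 0)
    (hu : MemD s p u) (hv : MemD s p v) : coupling 0 α β Ω u v < ∞ := by
  obtain ⟨hu1, hu2, -⟩ := (memD_iff hs0 hp hd).1 hu
  obtain ⟨hv1, hv2, -⟩ := (memD_iff hs0 hp hd).1 hv
  calc coupling 0 α β Ω u v ≤ ∫⁻ x, (ENNReal.ofReal (|u x| ^ critExp d s p 0) +
          ENNReal.ofReal (|v x| ^ critExp d s p 0)) := by
        refine (setLIntegral_le_lintegral _ _).trans (lintegral_mono fun x ↦ ?_)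
        rw [← ENNReal.ofReal_add (by positivity) (by positivity), ← hq, Real.rpow_zero, div_one]
        exact ENNReal.ofReal_le_ofReal ((rpow_mul_rpow_le_max (by linarith) (by linarith)
          (abs_nonneg _) (abs_nonneg _)).trans (max_rpow_le (abs_nonneg _) (abs_nonneg _)))
    _ = powInt (critExp d s p 0) u + powInt (critExp d s p 0) v :=
        lintegral_add_left' (aemeasurable_powInt hu1) _
    _ < ∞ := ENNReal.add_lt_top.2 ⟨hu2, hv2⟩

end Coupling

/-! ### The space `W_0^{s,p}` and the best constant -/

section Space

variable {d : ℕ} {s p m α β : ℝ} {Ω : Set (Euc d)} {u v : Euc d → ℝ}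

lemma nontrivial_euc (hd : 0 < (d : ℝ)) : Nontrivial (Euc d) := by
  have : 0 < d := by exact_mod_cast hd
  exact Module.nontrivial_of_finrank_pos (R := ℝ) (by rwa [finrank_euclideanSpace, Fintype.card_fin])

lemma MemD.aemeasurable (hu : MemD s p u) : AEMeasurable u := hu.1.1.aemeasurable

lemma memD_const_mul (hs0 : 0 < s) (hp : 1 < p) (hd : s * p < d) (hu : MemD s p u) (t : ℝ) :
    MemD s p fun x ↦ t * u x := by
  obtain ⟨h1, h2, h3⟩ := (memD_iff hs0 hp hd).1 hu
  refine (memD_iff hs0 hp hd).2 ⟨h1.const_mul t, ?_, ?_⟩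
  · rw [powInt_const_mul]
    exact ENNReal.mul_lt_top ENNReal.ofReal_lt_top h2
  · rw [gagliardoPow_const_mul]
    exact ENNReal.mul_lt_top ENNReal.ofReal_lt_top h3

lemma memD_abs (hs0 : 0 < s) (hp : 1 < p) (hd : s * p < d) (hu : MemD s p u) :
    MemD s p fun x ↦ |u x| := by
  obtain ⟨h1, h2, h3⟩ := (memD_iff hs0 hp hd).1 hu
  refine (memD_iff hs0 hp hd).2 ⟨continuous_abs.measurable.comp_aemeasurable h1, ?_,
    (gagliardoPow_abs_le (by linarith)).trans_lt h3⟩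
  simpa [powInt] using h2

lemma gagDens_max_le (hp : 0 ≤ p) (x y : Euc d) :
    gagDens s p (fun x ↦ max (u x) (v x)) x y ≤ gagDens s p u x y + gagDens s p v x y := by
  unfold gagDens
  rw [← ENNReal.ofReal_add (by positivity) (by positivity), ← add_div]
  refine ENNReal.ofReal_le_ofReal ?_
  gcongr
  exact (Real.rpow_le_rpow (abs_nonneg _) (abs_max_sub_max_le_max _ _ _ _) hp).trans
    (max_rpow_le (abs_nonneg _) (abs_nonneg _))

lemma memD_max (hs0 : 0 < s) (hp : 1 < p) (hd : s * p < d) (hu : MemD s p u) (hv : MemD s p v) :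
    MemD s p fun x ↦ max (u x) (v x) := by
  have hr : 0 < critExp d s p 0 := by have := lt_critExp hs0 hp hd; linarith
  obtain ⟨h1, h2, h3⟩ := (memD_iff hs0 hp hd).1 hu
  obtain ⟨h1', h2', h3'⟩ := (memD_iff hs0 hp hd).1 hv
  refine (memD_iff hs0 hp hd).2 ⟨h1.max h1', ?_, ?_⟩
  · calc powInt (critExp d s p 0) (fun x ↦ max (u x) (v x))
        ≤ ∫⁻ x, (ENNReal.ofReal (|u x| ^ critExp d s p 0) +
            ENNReal.ofReal (|v x| ^ critExp d s p 0)) := by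
          refine lintegral_mono fun x ↦ ?_
          rw [← ENNReal.ofReal_add (by positivity) (by positivity)]
          refine ENNReal.ofReal_le_ofReal ?_
          exact (Real.rpow_le_rpow (abs_nonneg _) abs_max_le_max_abs_abs hr.le).trans
            (max_rpow_le (abs_nonneg _) (abs_nonneg _))
      _ < ∞ := by
          rw [lintegral_add_left' (aemeasurable_powInt h1)]
          exact ENNReal.add_lt_top.2 ⟨h2, h2'⟩
  · calc gagliardoPow s p (fun x ↦ max (u x) (v x))
        ≤ ∫⁻ z : Euc d × Euc d, (gagDens s p u z.1 z.2 + gagDens s p v z.1 z.2) :=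
          lintegral_mono fun z ↦ gagDens_max_le (by linarith) _ _
      _ < ∞ := by
          rw [Measure.volume_eq_prod, lintegral_add_left' (aemeasurable_gagDens h1)]
          exact ENNReal.add_lt_top.2 ⟨h3, h3'⟩

lemma memW0_abs (hs0 : 0 < s) (hp : 1 < p) (hd : s * p < d) (hu : MemW0 s p Ω u) :
    MemW0 s p Ω fun x ↦ |u x| := by
  refine ⟨memD_abs hs0 hp hd hu.1, ?_⟩
  filter_upwards [hu.2] with x hx hxΩ
  rw [hx hxΩ, abs_zero]

lemma memW0_const_mul (hs0 : 0 < s) (hp : 1 < p) (hd : s * p < d) (hu : MemW0 s p Ω u) (t : ℝ) :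
    MemW0 s p Ω fun x ↦ t * u x := by
  refine ⟨memD_const_mul hs0 hp hd hu.1 t, ?_⟩
  filter_upwards [hu.2] with x hx hxΩ
  rw [hx hxΩ, mul_zero]

lemma memW0_max (hs0 : 0 < s) (hp : 1 < p) (hd : s * p < d) (hu : MemW0 s p Ω u)
    (hv : MemW0 s p Ω v) : MemW0 s p Ω fun x ↦ max (u x) (v x) := by
  refine ⟨memD_max hs0 hp hd hu.1 hv.1, ?_⟩
  filter_upwards [hu.2, hv.2] with x hx hx' hxΩ
  rw [hx hxΩ, hx' hxΩ, max_self]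

lemma memW0_tent (hs0 : 0 < s) (hs1 : s < 1) (hp : 1 < p) (hd : s * p < d) {c : Euc d} {R : ℝ}
    (hR : 0 < R) (hΩ : Metric.ball c R ⊆ Ω) : MemW0 s p Ω (tent c R) :=
  ⟨memD_tent hs0 hs1 hp hd c hR, Eventually.of_forall fun _ hx ↦
    tent_eq_zero hR fun h ↦ hx (hΩ h)⟩

lemma not_ae_eq_zero_of_coupling_ne_zero (hα : 0 < α) (hβ : 0 < β)
    (h : coupling m α β Ω u v ≠ 0) : ¬ u =ᵐ[volume] 0 ∧ ¬ v =ᵐ[volume] 0 :=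
  ⟨fun hu ↦ h (coupling_eq_zero_left hα hu), fun hv ↦ h (coupling_eq_zero_right hβ hv)⟩

lemma bestConst_le_rayleigh (hu : u ∈ W0NonZero s p Ω) (hv : v ∈ W0NonZero s p Ω) :
    bestConst s p m α β Ω ≤ rayleigh s p m α β Ω u v :=
  (iInf₂_le u hu).trans (iInf₂_le v hv)

/-- The defining inequality of the best constant, without division. -/
lemma bestConst_mul_le (hp : 1 < p) (hα : 1 < α) (hβ : 1 < β) (hu : MemW0 s p Ω u)
    (hv : MemW0 s p Ω v) :
    bestConst s p m α β Ω * coupling m α β Ω u v ^ (p / (α + β)) ≤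
      gagliardoPow s p u + gagliardoPow s p v := by
  by_cases h0 : coupling m α β Ω u v = 0
  · have : 0 < p / (α + β) := by apply div_pos <;> linarith
    rw [h0, ENNReal.zero_rpow_of_pos this, mul_zero]
    exact zero_le
  · obtain ⟨h1, h2⟩ := not_ae_eq_zero_of_coupling_ne_zero (by linarith) (by linarith) h0
    exact ENNReal.mul_le_of_le_div (bestConst_le_rayleigh ⟨hu, h1⟩ ⟨hv, h2⟩)

lemma coupling_ne_zero_of_rayleigh_lt_top (hs0 : 0 < s) (hp : 1 < p) (hd : s * p < d)
    (hα : 1 < α) (hβ : 1 < β) (hu : u ∈ W0NonZero s p Ω)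
    (h : rayleigh s p m α β Ω u v < ∞) : coupling m α β Ω u v ≠ 0 := by
  intro h0
  have : 0 < p / (α + β) := by apply div_pos <;> linarith
  unfold rayleigh at h
  rw [h0, ENNReal.zero_rpow_of_pos this, ENNReal.div_zero] at h
  · exact lt_irrefl _ h
  · have := gagliardoPow_ne_zero hs0 hp hd hu.1.1 hu.2
    simp [this]

lemma coupling_tent_ne_zero (hd : 0 < (d : ℝ)) {c : Euc d} {R : ℝ} (hR : 0 < R)
    (hΩo : IsOpen Ω) (hΩ : Metric.ball c R ⊆ Ω) :
    coupling m α β Ω (tent c R) (tent c R) ≠ 0 := by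
  have := nontrivial_euc hd
  intro h0
  change ∫⁻ x in Ω, couplingDens m α β (tent c R) (tent c R) x = 0 at h0
  have hmeas : AEMeasurable (couplingDens m α β (tent c R) (tent c R)) (volume.restrict Ω) :=
    (aemeasurable_couplingDens (continuous_tent c R).measurable.aemeasurable
      (continuous_tent c R).measurable.aemeasurable).restrict
  rw [lintegral_eq_zero_iff' hmeas, EventuallyEq, ae_restrict_iff' hΩo.measurableSet] at h0
  have h1 : ∀ᵐ x : Euc d, x ≠ 0 := Measure.ae_ne volume 0
  have h2 : ∀ᵐ x : Euc d, x ∉ Metric.ball c R := by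
    filter_upwards [h0, h1] with x hx hx0 hxB
    have h3 := tent_pos hR hxB
    have h4 : 0 < ‖x‖ := norm_pos_iff.2 hx0
    have h5 := hx (hΩ hxB)
    simp only [couplingDens, Pi.zero_apply, ENNReal.ofReal_eq_zero] at h5
    have : 0 < |tent c R x| := abs_pos.2 h3.ne'
    have : 0 < |tent c R x| ^ α * |tent c R x| ^ β / ‖x‖ ^ m := by positivity
    linarith
  have h3 : volume (Metric.ball c R) = 0 := by
    exact measure_eq_zero_iff_ae_notMem.2 h2
  exact (Metric.measure_ball_pos volume c hR).ne' h3

lemma bestConst_lt_top (hs0 : 0 < s) (hs1 : s < 1) (hp : 1 < p) (hd : s * p < d)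
    (hα : 1 < α) (hβ : 1 < β) (hΩo : IsOpen Ω) (hne : Ω.Nonempty) :
    bestConst s p m α β Ω < ∞ := by
  obtain ⟨c, hc⟩ := hne
  obtain ⟨R, hR, hΩ⟩ := Metric.isOpen_iff.1 hΩo c hc
  have hsp : 0 < s * p := by positivity
  have h0 : coupling m α β Ω (tent c R) (tent c R) ≠ 0 :=
    coupling_tent_ne_zero (by linarith) hR hΩo hΩ
  have hW : tent c R ∈ W0NonZero s p Ω := ⟨memW0_tent hs0 hs1 hp hd hR hΩ,
    (not_ae_eq_zero_of_coupling_ne_zero (by linarith) (by linarith) h0).1⟩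
  refine (bestConst_le_rayleigh hW hW).trans_lt ?_
  refine ENNReal.div_lt_top (ENNReal.add_lt_top.2 ⟨hW.1.1.2, hW.1.1.2⟩).ne ?_
  intro h
  rw [ENNReal.rpow_eq_zero_iff] at h
  rcases h with ⟨h, -⟩ | ⟨-, h⟩
  · exact h0 h
  · have : 0 < p / (α + β) := by apply div_pos <;> linarith
    linarith

/-- A ground state saturates the defining inequality of the best constant. -/
lemma IsGroundState.gagliardoPow_add_eq (hs0 : 0 < s) (hs1 : s < 1) (hp : 1 < p) (hd : s * p < d)
    (hα : 1 < α) (hβ : 1 < β) (hΩo : IsOpen Ω) (hne : Ω.Nonempty)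
    (h : IsGroundState s p m α β Ω u v) (hc : coupling m α β Ω u v ≠ ∞) :
    gagliardoPow s p u + gagliardoPow s p v =
      bestConst s p m α β Ω * coupling m α β Ω u v ^ (p / (α + β)) := by
  obtain ⟨hu, hv, h⟩ := h
  have h0 : coupling m α β Ω u v ≠ 0 := coupling_ne_zero_of_rayleigh_lt_top hs0 hp hd hα hβ hu
    (h.trans_lt (bestConst_lt_top hs0 hs1 hp hd hα hβ hΩo hne))
  rw [← h, rayleigh, ENNReal.div_mul_cancel]
  · simp [ENNReal.rpow_eq_zero_iff, h0, hc]
  · have : 0 ≤ p / (α + β) := by apply div_nonneg <;> linarith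
    exact ENNReal.rpow_ne_top_of_nonneg this hc

lemma IsGroundState.abs (hs0 : 0 < s) (hp : 1 < p) (hd : s * p < d)
    (h : IsGroundState s p m α β Ω u v) :
    IsGroundState s p m α β Ω (fun x ↦ |u x|) (fun x ↦ |v x|) := by
  obtain ⟨hu, hv, h⟩ := h
  have habs : ∀ {w : Euc d → ℝ}, w ∈ W0NonZero s p Ω → (fun x ↦ |w x|) ∈ W0NonZero s p Ω := by
    refine fun {w} hw ↦ ⟨memW0_abs hs0 hp hd hw.1, fun h0 ↦ hw.2 ?_⟩
    filter_upwards [h0] with x hx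
    simpa using hx
  refine ⟨habs hu, habs hv, le_antisymm ?_ (bestConst_le_rayleigh (habs hu) (habs hv))⟩
  rw [← h]
  have hc : coupling m α β Ω (fun x ↦ |u x|) (fun x ↦ |v x|) = coupling m α β Ω u v := by
    simp [coupling]
  unfold rayleigh
  rw [hc]
  gcongr
  · exact gagliardoPow_abs_le (by linarith)
  · exact gagliardoPow_abs_le (by linarith)

end Space

/-! ### The strong maximum principle -/

section Positivity

variable {d : ℕ} {s p : ℝ} {u ψ : Euc d → ℝ}

/-- The inequality behind the maximum principle: raising `u` to `max(u, ε ψ)` gains an amount linear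
in `ε` on the pairs `(x, y)` with `u(x) ≥ a`, `u(y) = 0`, `ψ(y) ≥ b`. -/
lemma gagDens_max_add_le (hp : 1 < p) (hψ0 : ∀ x, 0 ≤ ψ x)
    (hψ1 : ∀ x, ψ x ≤ 1) {a b ε : ℝ} (hb : 0 < b) (hε : 0 < ε) (hεa : ε ≤ a) (x y : Euc d) :
    gagDens s p (fun x ↦ max (u x) (ε * ψ x)) x y + ENNReal.ofReal (a ^ (p - 1) * b * ε) *
      ({x | a ≤ u x} ×ˢ {y | u y = 0 ∧ b ≤ ψ y}).indicator
        (fun z : Euc d × Euc d ↦ ENNReal.ofReal (1 / ‖z.1 - z.2‖ ^ ((d : ℝ) + s * p))) (x, y) ≤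
      gagDens s p u x y + ENNReal.ofReal (ε ^ p) * gagDens s p ψ x y := by
  have hp0 : 0 ≤ p := by linarith
  have ha : 0 < a := hε.trans_le hεa
  by_cases hz : (x, y) ∈ ({x | a ≤ u x} ×ˢ {y | u y = 0 ∧ b ≤ ψ y} : Set (Euc d × Euc d))
  · rw [Set.indicator_of_mem hz]
    obtain ⟨hx, hy0, hyb⟩ := hz
    refine le_trans ?_ le_self_add
    unfold gagDens
    simp only at hx hy0 hyb ⊢
    rw [Set.mem_ofPred_eq] at hx
    rw [← ENNReal.ofReal_mul (by positivity), ← ENNReal.ofReal_add (by positivity) (by positivity)]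
    refine ENNReal.ofReal_le_ofReal ?_
    rw [mul_one_div, ← add_div]
    gcongr
    have ht0 : 0 ≤ ε * ψ y := mul_nonneg hε.le (hψ0 y)
    have ht1 : ε * ψ y ≤ u x := by nlinarith [hψ1 y]
    have hx1 : ε * ψ x ≤ u x := by nlinarith [hψ1 x]
    have htb : b * ε ≤ ε * ψ y := by nlinarith
    rw [hy0, max_eq_left hx1, max_eq_right ht0, sub_zero, abs_of_nonneg (by linarith),
      abs_of_nonneg (by linarith)]
    set U := u x with hU
    set t := ε * ψ y with ht
    have hU0 : 0 < U := ha.trans_le hx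
    -- `(U - t)^p ≤ U^(p-1) (U - t) = U^p - U^(p-1) t`
    have e1 : ∀ w : ℝ, 0 ≤ w → w ^ p = w ^ (p - 1) * w := fun w hw ↦ by
      rw [← Real.rpow_add_one' hw (by linarith)]
      simp
    have e2 : (U - t) ^ (p - 1) ≤ U ^ (p - 1) :=
      Real.rpow_le_rpow (by linarith) (by linarith) (by linarith)
    have e3 : a ^ (p - 1) ≤ U ^ (p - 1) := Real.rpow_le_rpow ha.le hx (by linarith)
    have e4 : 0 ≤ a ^ (p - 1) := by positivity
    rw [e1 _ (by linarith), e1 U hU0.le]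
    calc (U - t) ^ (p - 1) * (U - t) + a ^ (p - 1) * b * ε
        ≤ U ^ (p - 1) * (U - t) + a ^ (p - 1) * (b * ε) := by
          have := mul_le_mul_of_nonneg_right e2 (by linarith : 0 ≤ U - t)
          linarith
      _ ≤ U ^ (p - 1) * (U - t) + U ^ (p - 1) * t := by
          have := mul_le_mul e3 htb (by positivity) (by positivity)
          linarith
      _ = _ := by ring
  · rw [Set.indicator_of_notMem hz, mul_zero, add_zero]
    refine (gagDens_max_le hp0 x y).trans (le_of_eq ?_)
    congr 1
    unfold gagDens
    rw [← ENNReal.ofReal_mul (by positivity), ← mul_sub, abs_mul, abs_of_pos hε,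
      Real.mul_rpow hε.le (abs_nonneg _), mul_div_assoc]

/-- A strong maximum principle: a nonnegative `u ≠ 0` whose seminorm does not decrease when `u` is
replaced by `max(u, ε ψ)`, for all small `ε`, cannot vanish on a set of positive measure where
`ψ > 0`. The gain is linear in `ε`, while the cost is at most `ε^p [ψ]^p` with `p > 1`. -/
theorem ae_pos_of_gagliardoPow_le_max (hp : 1 < p) (hu : AEMeasurable u)
    (hu0 : ∀ x, 0 ≤ u x) (hune : ¬ u =ᵐ[volume] 0) (hug : gagliardoPow s p u < ∞)
    (hψ : AEMeasurable ψ) (hψ0 : ∀ x, 0 ≤ ψ x) (hψ1 : ∀ x, ψ x ≤ 1) (hψg : gagliardoPow s p ψ < ∞)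
    (hmin : ∀ ε > 0, gagliardoPow s p u ≤ gagliardoPow s p fun x ↦ max (u x) (ε * ψ x)) :
    ∀ᵐ x, 0 < ψ x → 0 < u x := by
  by_contra hcon
  have hZ : ∃ k : ℕ, volume {y | u y = 0 ∧ 1 / ((k : ℝ) + 1) ≤ ψ y} ≠ 0 := by
    by_contra! hall
    apply hcon
    have h1 : ∀ᵐ y, ∀ k : ℕ, ¬ (u y = 0 ∧ 1 / ((k : ℝ) + 1) ≤ ψ y) :=
      ae_all_iff.2 fun k ↦ by simpa [ae_iff] using hall k
    filter_upwards [h1] with y hy hψy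
    obtain ⟨k, hk⟩ := exists_nat_one_div_lt hψy
    refine lt_of_le_of_ne (hu0 y) fun h0 ↦ hy k ⟨h0.symm, hk.le⟩
  have hA : ∃ k : ℕ, volume {x | 1 / ((k : ℝ) + 1) ≤ u x} ≠ 0 := by
    by_contra! hall
    apply hune
    have h1 : ∀ᵐ y, ∀ k : ℕ, ¬ (1 / ((k : ℝ) + 1) ≤ u y) :=
      ae_all_iff.2 fun k ↦ by simpa [ae_iff] using hall k
    filter_upwards [h1] with y hy
    by_contra hne
    obtain ⟨k, hk⟩ := exists_nat_one_div_lt (lt_of_le_of_ne (hu0 y) (Ne.symm hne))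
    exact hy k hk.le
  obtain ⟨kb, hZ⟩ := hZ
  obtain ⟨ka, hA⟩ := hA
  set b : ℝ := 1 / ((kb : ℝ) + 1)
  set a : ℝ := 1 / ((ka : ℝ) + 1)
  have hb : 0 < b := by positivity
  have ha : 0 < a := by positivity
  set A : Set (Euc d) := {x | a ≤ u x} with hA_def
  set Z : Set (Euc d) := {y | u y = 0 ∧ b ≤ ψ y} with hZ_def
  set K : Euc d × Euc d → ℝ≥0∞ := (A ×ˢ Z).indicator
    (fun z : Euc d × Euc d ↦ ENNReal.ofReal (1 / ‖z.1 - z.2‖ ^ ((d : ℝ) + s * p))) with hK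
  have hAm : NullMeasurableSet A := nullMeasurableSet_le aemeasurable_const hu
  have hZm : NullMeasurableSet Z := by
    refine NullMeasurableSet.inter ?_ (nullMeasurableSet_le aemeasurable_const hψ)
    exact nullMeasurableSet_eq_fun hu aemeasurable_const
  have hKm : AEMeasurable K ((volume : Measure (Euc d)).prod volume) :=
    AEMeasurable.indicator₀ (Measurable.aemeasurable (by fun_prop)) (hAm.prod hZm)
  set K₀ := ∫⁻ z, K z ∂((volume : Measure (Euc d)).prod volume) with hK₀_def
  have hK₀ : K₀ ≠ 0 := by
    intro h0
    rw [hK₀_def, lintegral_eq_zero_iff' hKm] at h0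
    have h1 : ((volume : Measure (Euc d)).prod volume) (A ×ˢ Z) = 0 := by
      have h2 : ∀ᵐ z ∂((volume : Measure (Euc d)).prod volume), z ∉ A ×ˢ Z := by
        filter_upwards [h0] with z hz hmem
        rw [hK, Set.indicator_of_mem hmem] at hz
        have hne : z.1 ≠ z.2 := by
          intro he
          have h3 : a ≤ u z.1 := hmem.1
          have h4 : u z.2 = 0 := hmem.2.1
          rw [he, h4] at h3
          linarith
        have h5 : 0 < ‖z.1 - z.2‖ := norm_pos_iff.2 (sub_ne_zero.2 hne)
        have h6 : 0 < 1 / ‖z.1 - z.2‖ ^ ((d : ℝ) + s * p) := by positivity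
        simp only [Pi.zero_apply, ENNReal.ofReal_eq_zero] at hz
        linarith
      exact measure_eq_zero_iff_ae_notMem.2 h2
    rw [Measure.prod_prod, mul_eq_zero] at h1
    exact h1.elim hA hZ
  -- compare the two sides after integration
  have hineq : ∀ ε : ℝ, 0 < ε → ε ≤ a → ENNReal.ofReal (a ^ (p - 1) * b) * K₀ ≤
      ENNReal.ofReal (ε ^ (p - 1)) * gagliardoPow s p ψ := by
    intro ε hε hεa
    set w : Euc d → ℝ := fun x ↦ max (u x) (ε * ψ x) with hw
    have hwm : AEMeasurable w := hu.max (hψ.const_mul ε)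
    have hwg : gagliardoPow s p w ≤ gagliardoPow s p u + ENNReal.ofReal (ε ^ p) *
        gagliardoPow s p ψ ∧ gagliardoPow s p w + ENNReal.ofReal (a ^ (p - 1) * b * ε) * K₀ ≤
        gagliardoPow s p u + ENNReal.ofReal (ε ^ p) * gagliardoPow s p ψ := by
      have h1 : gagliardoPow s p w + ENNReal.ofReal (a ^ (p - 1) * b * ε) * K₀ ≤
        gagliardoPow s p u + ENNReal.ofReal (ε ^ p) * gagliardoPow s p ψ := by
        rw [hK₀_def, ← lintegral_const_mul' _ _ ENNReal.ofReal_ne_top, gagliardoPow_eq_dens,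
          gagliardoPow_eq_dens, gagliardoPow_eq_dens, Measure.volume_eq_prod,
          ← lintegral_const_mul' _ _ ENNReal.ofReal_ne_top,
          ← lintegral_add_left' (aemeasurable_gagDens hwm),
          ← lintegral_add_left' (aemeasurable_gagDens hu)]
        exact lintegral_mono fun z ↦ gagDens_max_add_le hp hψ0 hψ1 hb hε hεa z.1 z.2
      exact ⟨le_self_add.trans h1, h1⟩
    have hwfin : gagliardoPow s p w ≠ ∞ := ne_top_of_le_ne_top (ENNReal.add_ne_top.2
      ⟨hug.ne, ENNReal.mul_ne_top ENNReal.ofReal_ne_top hψg.ne⟩) hwg.1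
    have h2 : gagliardoPow s p w + ENNReal.ofReal (a ^ (p - 1) * b * ε) * K₀ ≤
        gagliardoPow s p w + ENNReal.ofReal (ε ^ p) * gagliardoPow s p ψ :=
      hwg.2.trans (by gcongr; exact hmin ε hε)
    have h3 := (ENNReal.add_le_add_iff_left hwfin).1 h2
    have e1 : ε ^ p = ε * ε ^ (p - 1) := by
      rw [mul_comm, ← Real.rpow_add_one hε.ne']
      simp
    rw [mul_comm (a ^ (p - 1) * b) ε, e1, ENNReal.ofReal_mul hε.le, ENNReal.ofReal_mul hε.le,
      mul_assoc, mul_assoc, ENNReal.mul_le_mul_iff_right (by simpa using hε)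
        ENNReal.ofReal_ne_top] at h3
    exact h3
  have hlim : Tendsto (fun ε : ℝ ↦ ENNReal.ofReal (ε ^ (p - 1)) * gagliardoPow s p ψ) (𝓝[>] 0)
      (𝓝 0) := by
    have h1 : Tendsto (fun ε : ℝ ↦ ε ^ (p - 1)) (𝓝 0) (𝓝 ((0 : ℝ) ^ (p - 1))) :=
      tendsto_id.rpow_const (Or.inr (by linarith))
    rw [Real.zero_rpow (by linarith)] at h1
    have h2 := ENNReal.Tendsto.mul_const (ENNReal.tendsto_ofReal h1) (Or.inr hψg.ne)
    rw [ENNReal.ofReal_zero, zero_mul] at h2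
    exact h2.mono_left nhdsWithin_le_nhds
  have hle : ENNReal.ofReal (a ^ (p - 1) * b) * K₀ ≤ 0 := by
    refine ge_of_tendsto hlim ?_
    filter_upwards [Ioc_mem_nhdsGT ha] with ε hε
    exact hineq ε hε.1 hε.2
  have h0 : ENNReal.ofReal (a ^ (p - 1) * b) ≠ 0 := by
    simp only [ne_eq, ENNReal.ofReal_eq_zero, not_le]
    positivity
  rcases mul_eq_zero.1 (le_antisymm hle zero_le) with h | h
  · exact h0 h
  · exact hK₀ h

/-- The local form: it suffices to test with tent functions of small balls contained in `Ω`. -/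
lemma ae_restrict_pos_of_forall_tent {Ω : Set (Euc d)} (hΩo : IsOpen Ω) (hu0 : ∀ x, 0 ≤ u x)
    (h : ∀ c R, 0 < R → Metric.ball c R ⊆ Ω → ∀ᵐ x, 0 < tent c R x → 0 < u x) :
    ∀ᵐ x ∂(volume.restrict Ω), 0 < u x := by
  rw [ae_restrict_iff' hΩo.measurableSet]
  by_contra hcon
  have hZ : volume (Ω ∩ {x | u x = 0}) ≠ 0 := by
    intro h0
    apply hcon
    have h1 : ∀ᵐ x, x ∉ Ω ∩ {x | u x = 0} := measure_eq_zero_iff_ae_notMem.1 h0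
    filter_upwards [h1] with x hx hxΩ
    exact lt_of_le_of_ne (hu0 x) fun h0 ↦ hx ⟨hxΩ, h0.symm⟩
  obtain ⟨c, hc, hpos⟩ := exists_mem_forall_mem_nhdsWithin_pos_measure hZ
  obtain ⟨R, hR, hB⟩ := Metric.isOpen_iff.1 hΩo c hc.1
  have h1 := hpos _ (inter_mem_nhdsWithin _ (Metric.ball_mem_nhds c hR))
  refine h1.ne' (measure_mono_null ?_ (ae_iff.1 (h c R hR hB)))
  rintro x ⟨⟨-, hx0⟩, hxB⟩
  simp only [Set.mem_ofPred_eq, Classical.not_imp, not_lt] at hx0 ⊢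
  exact ⟨tent_pos hR hxB, hx0.le⟩

end Positivity

/-! ### Ground states in the subcritical case -/

section Existence

variable {d : ℕ} {s p m α β : ℝ} {Ω : Set (Euc d)} {u v : Euc d → ℝ}

/-- The quotient is invariant under `(u, v) ↦ (t u, t v)`, so the coupling integral can be
normalized to `1`. -/
lemma exists_coupling_eq_one (hs0 : 0 < s) (hp : 1 < p) (hd : s * p < d)
    (hα : 1 < α) (hβ : 1 < β) (hu : MemW0 s p Ω u) (hv : MemW0 s p Ω v)
    (h0 : coupling m α β Ω u v ≠ 0) (hfin : coupling m α β Ω u v ≠ ∞) :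
    ∃ u' v', MemW0 s p Ω u' ∧ MemW0 s p Ω v' ∧ coupling m α β Ω u' v' = 1 ∧
      gagliardoPow s p u' + gagliardoPow s p v' = rayleigh s p m α β Ω u v := by
  have hq : 0 < α + β := by linarith
  set c := coupling m α β Ω u v with hc
  set C := c.toReal
  have hC : 0 < C := ENNReal.toReal_pos h0 hfin
  have hcC : c = ENNReal.ofReal C := (ENNReal.ofReal_toReal hfin).symm
  set t : ℝ := C ^ (-1 / (α + β)) with ht_def
  have ht : 0 < t := by positivity
  refine ⟨fun x ↦ t * u x, fun x ↦ t * v x, memW0_const_mul hs0 hp hd hu t,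
    memW0_const_mul hs0 hp hd hv t, ?_, ?_⟩
  · rw [coupling_const_mul, ← hc, hcC, abs_of_pos ht, ← Real.rpow_add ht,
      ← ENNReal.ofReal_mul (by positivity), ht_def, ← Real.rpow_mul hC.le,
      div_mul_cancel₀ _ hq.ne', Real.rpow_neg_one, inv_mul_cancel₀ hC.ne', ENNReal.ofReal_one]
  · have e1 : |t| ^ p = (C ^ (p / (α + β)))⁻¹ := by
      rw [abs_of_pos ht, ht_def, ← Real.rpow_mul hC.le, ← Real.rpow_neg hC.le]
      congr 1
      ring
    rw [gagliardoPow_const_mul, gagliardoPow_const_mul, ← mul_add, rayleigh, ← hc, hcC,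
      ENNReal.ofReal_rpow_of_pos hC, e1, ENNReal.ofReal_inv_of_pos (by positivity), mul_comm]
    exact (div_eq_mul_inv _ _).symm

/-- Existence of a minimizer in the subcritical case, by the direct method. -/
theorem exists_isGroundState (hs0 : 0 < s) (hs1 : s < 1) (hp : 1 < p) (hd : s * p < d)
    (hm : 0 ≤ m) (hα : 1 < α) (hβ : 1 < β) (hq : α + β < critExp d s p m)
    (hΩo : IsOpen Ω) (hΩb : Bornology.IsBounded Ω) (hne : Ω.Nonempty) :
    ∃ u v, IsGroundState s p m α β Ω u v := by
  have hr : 0 < critExp d s p 0 := by have := lt_critExp hs0 hp hd; linarith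
  have hS := bestConst_lt_top (m := m) hs0 hs1 hp hd hα hβ hΩo hne
  set S := bestConst s p m α β Ω with hS_def
  have hseq : ∀ n : ℕ, ∃ u v, MemW0 s p Ω u ∧ MemW0 s p Ω v ∧ coupling m α β Ω u v = 1 ∧
      gagliardoPow s p u + gagliardoPow s p v ≤ S + ((n : ℝ≥0∞) + 1)⁻¹ := by
    intro n
    have h1 : bestConst s p m α β Ω < S + ((n : ℝ≥0∞) + 1)⁻¹ :=
      ENNReal.lt_add_right hS.ne (by simp)
    obtain ⟨u, hu, v, hv, h⟩ : ∃ u ∈ W0NonZero s p Ω, ∃ v ∈ W0NonZero s p Ω,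
        rayleigh s p m α β Ω u v < S + ((n : ℝ≥0∞) + 1)⁻¹ := by
      simpa only [bestConst, iInf_lt_iff, exists_prop] using h1
    obtain ⟨u', v', hu', hv', hc, hr⟩ := exists_coupling_eq_one hs0 hp hd hα hβ hu.1 hv.1
      (coupling_ne_zero_of_rayleigh_lt_top hs0 hp hd hα hβ hu (h.trans_le le_top))
      (coupling_lt_top_of_subcritical hs0 hp hd hm hα hβ hq hΩb hu.1.1 hv.1.1).ne
    exact ⟨u', v', hu', hv', hc, hr.trans_le h.le⟩
  choose f g hf hg hfg hle using hseq
  have hle1 : ∀ n, gagliardoPow s p (f n) + gagliardoPow s p (g n) ≤ S + 1 := fun n ↦ by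
    refine (hle n).trans ?_
    gcongr
    rw [ENNReal.inv_le_one]
    exact le_add_self
  have hM : S + 1 ≠ ∞ := ENNReal.add_ne_top.2 ⟨hS.ne, ENNReal.one_ne_top⟩
  obtain ⟨R, hR⟩ := hΩb.subset_ball (0 : Euc d)
  have hsupp : ∀ {w : Euc d → ℝ}, MemW0 s p Ω w →
      ∀ᵐ x : Euc d, x ∉ Metric.ball (0 : Euc d) R → w x = 0 := fun hw ↦ by
    filter_upwards [hw.2] with x hx hxB
    exact hx fun h ↦ hxB (hR h)
  obtain ⟨u, φ, hum, hφ, hfu⟩ := exists_subseq_tendsto_ae hs0 hp hd hM (fun n ↦ (hf n).1)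
    (fun n ↦ hsupp (hf n)) fun n ↦ le_self_add.trans (hle1 n)
  obtain ⟨v, ψ, hvm, hψ, hgv⟩ := exists_subseq_tendsto_ae hs0 hp hd hM
    (fun n ↦ (hg (φ n)).1) (fun n ↦ hsupp (hg (φ n))) fun n ↦ le_add_self.trans (hle1 (φ n))
  set τ : ℕ → ℕ := φ ∘ ψ with hτ
  have hτm : StrictMono τ := hφ.comp hψ
  have hfu' : ∀ᵐ x, Tendsto (fun n ↦ f (τ n) x) atTop (𝓝 (u x)) := by
    filter_upwards [hfu] with x hx
    exact hx.comp hψ.tendsto_atTop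
  have hgv' : ∀ᵐ x, Tendsto (fun n ↦ g (τ n) x) atTop (𝓝 (v x)) := hgv
  have hfm : ∀ n, AEMeasurable (f n) := fun n ↦ (hf n).1.aemeasurable
  have hgm : ∀ n, AEMeasurable (g n) := fun n ↦ (hg n).1.aemeasurable
  -- lower semicontinuity of the numerator
  have hlow : gagliardoPow s p u + gagliardoPow s p v ≤ S := by
    refine (gagliardoPow_add_le_liminf (by linarith) (fun n ↦ hfm (τ n)) (fun n ↦ hgm (τ n))
      hum.aemeasurable hfu' hgv').trans ?_
    have h1 : Tendsto (fun n : ℕ ↦ S + ((n : ℝ≥0∞) + 1)⁻¹) atTop (𝓝 (S + 0)) := by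
      refine tendsto_const_nhds.add ?_
      have h2 := (tendsto_add_atTop_iff_nat 1).2 ENNReal.tendsto_inv_nat_nhds_zero
      simpa using h2
    rw [add_zero] at h1
    calc _ ≤ liminf (fun n ↦ S + ((τ n : ℝ≥0∞) + 1)⁻¹) atTop :=
          liminf_le_liminf (Eventually.of_forall fun n ↦ hle (τ n))
      _ = S := (h1.comp hτm.tendsto_atTop).liminf_eq
  -- the `L^{p*_s}` modulars stay bounded
  obtain ⟨C, hC, hSob⟩ := exists_powInt_le hs0 hp hd
  set N : ℝ≥0∞ := (ENNReal.ofReal C * (S + 1)) ^ ((d : ℝ) / (d - s * p)) with hN_def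
  have hexp : 0 ≤ (d : ℝ) / (d - s * p) := by
    have : 0 < s * p := by positivity
    apply div_nonneg <;> linarith
  have hN : N ≠ ∞ :=
    ENNReal.rpow_ne_top_of_nonneg hexp (ENNReal.mul_ne_top ENNReal.ofReal_ne_top hM)
  have hfN : ∀ n, powInt (critExp d s p 0) (f n) ≤ N := fun n ↦ by
    refine (hSob _ (hf n).1).trans ?_
    rw [hN_def]
    have := le_self_add.trans (hle1 n)
    gcongr
  have hgN : ∀ n, powInt (critExp d s p 0) (g n) ≤ N := fun n ↦ by
    refine (hSob _ (hg n).1).trans ?_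
    rw [hN_def]
    have := le_add_self.trans (hle1 n)
    gcongr
  have hliminf : ∀ {a : ℕ → ℝ≥0∞}, (∀ n, a n ≤ N) → liminf a atTop ≤ N := fun h ↦ by
    refine (liminf_le_liminf (Eventually.of_forall h)).trans ?_
    rw [liminf_const]
  have huW : MemW0 s p Ω u := by
    refine ⟨(memD_iff hs0 hp hd).2 ⟨hum.aemeasurable, ?_, ?_⟩, ?_⟩
    · exact ((powInt_le_liminf hr (fun n ↦ hfm (τ n)) hfu').trans
        (hliminf fun n ↦ hfN (τ n))).trans_lt hN.lt_top
    · exact (le_self_add.trans hlow).trans_lt hS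
    · have h1 : ∀ᵐ x, ∀ n, x ∉ Ω → f n x = 0 := ae_all_iff.2 fun n ↦ (hf n).2
      filter_upwards [h1, hfu'] with x hx hx' hxΩ
      exact tendsto_nhds_unique hx' (tendsto_const_nhds.congr fun n ↦ (hx (τ n) hxΩ).symm)
  have hvW : MemW0 s p Ω v := by
    refine ⟨(memD_iff hs0 hp hd).2 ⟨hvm.aemeasurable, ?_, ?_⟩, ?_⟩
    · exact ((powInt_le_liminf hr (fun n ↦ hgm (τ n)) hgv').trans
        (hliminf fun n ↦ hgN (τ n))).trans_lt hN.lt_top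
    · exact (le_add_self.trans hlow).trans_lt hS
    · have h1 : ∀ᵐ x, ∀ n, x ∉ Ω → g n x = 0 := ae_all_iff.2 fun n ↦ (hg n).2
      filter_upwards [h1, hgv'] with x hx hx' hxΩ
      exact tendsto_nhds_unique hx' (tendsto_const_nhds.congr fun n ↦ (hx (τ n) hxΩ).symm)
  -- no loss of mass in the coupling integral
  have hc1 : 1 ≤ coupling m α β Ω u v := by
    obtain ⟨θ, M, hθ, hMf, hb⟩ :=
      exists_lintegral_rpow_couplingDens_le hs0 hp hd hm hα hβ hq hΩb
    have : IsFiniteMeasure (volume.restrict Ω) := ⟨by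
      rw [Measure.restrict_apply_univ]; exact hΩb.measure_lt_top⟩
    refine le_lintegral_of_tendsto_of_rpow_bound (μ := volume.restrict Ω) (M := N + N + M)
      (F := fun n ↦ couplingDens m α β (f (τ n)) (g (τ n))) hθ
      (ENNReal.add_ne_top.2 ⟨ENNReal.add_ne_top.2 ⟨hN, hN⟩, hMf⟩)
      (fun n ↦ (aemeasurable_couplingDens (hfm _) (hgm _)).restrict) ?_ ?_ ?_
    · refine ae_restrict_of_ae ?_
      filter_upwards [hfu', hgv'] with x hx hx'
      refine ENNReal.tendsto_ofReal (Tendsto.div_const ?_ _)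
      exact (hx.abs.rpow_const (Or.inr (by linarith))).mul
        (hx'.abs.rpow_const (Or.inr (by linarith)))
    · refine fun n ↦ (hb _ _ (hfm _) (hgm _)).trans ?_
      have h1 := hfN (τ n)
      have h2 := hgN (τ n)
      gcongr
    · exact fun n ↦ (hfg (τ n)).ge
  obtain ⟨hu0, hv0⟩ := not_ae_eq_zero_of_coupling_ne_zero (by linarith) (by linarith)
    (zero_lt_one.trans_le hc1).ne'
  refine ⟨u, v, ⟨huW, hu0⟩, ⟨hvW, hv0⟩,
    le_antisymm ?_ (bestConst_le_rayleigh ⟨huW, hu0⟩ ⟨hvW, hv0⟩)⟩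
  refine ENNReal.div_le_of_le_mul (hlow.trans ?_)
  have h1 : (1 : ℝ≥0∞) ≤ coupling m α β Ω u v ^ (p / (α + β)) :=
    ENNReal.one_le_rpow hc1 (by apply div_pos <;> linarith)
  exact le_mul_of_one_le_right' h1

/-- A nonnegative ground state with finite coupling integral is positive almost everywhere in `Ω`.
-/
theorem IsGroundState.ae_pos (hs0 : 0 < s) (hs1 : s < 1) (hp : 1 < p) (hd : s * p < d)
    (hα : 1 < α) (hβ : 1 < β) (hΩo : IsOpen Ω) (hne : Ω.Nonempty)
    (h : IsGroundState s p m α β Ω u v) (hc : coupling m α β Ω u v ≠ ∞)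
    (hu0 : ∀ x, 0 ≤ u x) (hv0 : ∀ x, 0 ≤ v x) :
    ∀ᵐ x ∂(volume.restrict Ω), 0 < u x ∧ 0 < v x := by
  have heq := h.gagliardoPow_add_eq hs0 hs1 hp hd hα hβ hΩo hne hc
  obtain ⟨hu, hv, -⟩ := h
  have hexp : 0 ≤ p / (α + β) := by apply div_nonneg <;> linarith
  have hmax : ∀ {w : Euc d → ℝ} {a : Euc d → ℝ} {ε : ℝ}, (∀ x, 0 ≤ w x) →
      ∀ x, |w x| ≤ |max (w x) (ε * a x)| := fun hw x ↦ by
    rw [abs_of_nonneg (hw x), abs_of_nonneg ((hw x).trans (le_max_left _ _))]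
    exact le_max_left _ _
  have h1 : ∀ᵐ x ∂(volume.restrict Ω), 0 < u x := by
    refine ae_restrict_pos_of_forall_tent hΩo hu0 fun c R hR hB ↦ ?_
    have hT := memW0_tent hs0 hs1 hp hd hR hB
    refine ae_pos_of_gagliardoPow_le_max hp hu.1.1.aemeasurable hu0 hu.2 hu.1.1.2
      hT.1.aemeasurable (tent_nonneg c R) (tent_le_one c hR) hT.1.2 fun ε hε ↦ ?_
    have hw := memW0_max hs0 hp hd hu.1 (memW0_const_mul hs0 hp hd hT ε)
    have h2 := bestConst_mul_le (m := m) hp hα hβ hw hv.1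
    refine (ENNReal.add_le_add_iff_right hv.1.1.2.ne).1 (le_trans ?_ h2)
    rw [heq]
    gcongr
    exact coupling_mono (by linarith) (by linarith) (hmax hu0) fun x ↦ le_rfl
  have h1' : ∀ᵐ x ∂(volume.restrict Ω), 0 < v x := by
    refine ae_restrict_pos_of_forall_tent hΩo hv0 fun c R hR hB ↦ ?_
    have hT := memW0_tent hs0 hs1 hp hd hR hB
    refine ae_pos_of_gagliardoPow_le_max hp hv.1.1.aemeasurable hv0 hv.2 hv.1.1.2
      hT.1.aemeasurable (tent_nonneg c R) (tent_le_one c hR) hT.1.2 fun ε hε ↦ ?_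
    have hw := memW0_max hs0 hp hd hv.1 (memW0_const_mul hs0 hp hd hT ε)
    have h2 := bestConst_mul_le (m := m) hp hα hβ hu.1 hw
    refine (ENNReal.add_le_add_iff_left hu.1.1.2.ne).1 (le_trans ?_ h2)
    rw [heq]
    gcongr
    exact coupling_mono (by linarith) (by linarith) (fun x ↦ le_rfl) (hmax hv0)
  exact h1.and h1'

end Existence

/-! ### Translations and dilations -/

section Rescaling

variable {d : ℕ} {s p α β : ℝ} {f g : Euc d → ℝ}

/-- The function `x ↦ f(a (x - c))`. -/
def rescale (a : ℝ) (c : Euc d) (f : Euc d → ℝ) (x : Euc d) : ℝ := f (a • (x - c))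

lemma lintegral_comp_smul_sub {a : ℝ} (ha : 0 < a) (c : Euc d) (F : Euc d → ℝ≥0∞) :
    ∫⁻ x, F (a • (x - c)) = ENNReal.ofReal (a ^ d)⁻¹ * ∫⁻ x, F x := by
  have h1 : ∫⁻ x, F (a • (x - c)) = ∫⁻ x, F (a • x) :=
    lintegral_sub_right_eq_self (fun x ↦ F (a • x)) c
  have h2 : ∫⁻ x, F (a • x) = ∫⁻ x, F x ∂(Measure.map (fun x : Euc d ↦ a • x) volume) :=
    ((Homeomorph.smulOfNeZero a ha.ne').measurableEmbedding.lintegral_map F).symm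
  rw [h1, h2, Measure.map_addHaar_smul _ ha.ne', lintegral_smul_measure, finrank_euclideanSpace,
    Fintype.card_fin, abs_of_pos (by positivity), smul_eq_mul]

lemma aemeasurable_rescale {a : ℝ} (ha : 0 < a) (c : Euc d) (hf : AEMeasurable f) :
    AEMeasurable (rescale a c f) :=
  hf.comp_quasiMeasurePreserving ((Measure.quasiMeasurePreserving_smul volume ha.ne').comp
    (measurePreserving_sub_right volume c).quasiMeasurePreserving)

lemma powInt_rescale {r a : ℝ} (ha : 0 < a) (c : Euc d) :
    powInt r (rescale a c f) = ENNReal.ofReal (a ^ d)⁻¹ * powInt r f :=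
  lintegral_comp_smul_sub ha c fun x ↦ ENNReal.ofReal (|f x| ^ r)

lemma gagliardoPow_rescale {a : ℝ} (ha : 0 < a) (c : Euc d) (hf : AEMeasurable f) :
    gagliardoPow s p (rescale a c f) = ENNReal.ofReal (a ^ (s * p - d)) * gagliardoPow s p f := by
  have hdens : ∀ x y, gagDens s p (rescale a c f) x y = ENNReal.ofReal (a ^ ((d : ℝ) + s * p)) *
      gagDens s p f (a • (x - c)) (a • (y - c)) := by
    intro x y
    unfold gagDens rescale
    have h1 : ‖a • (x - c) - a • (y - c)‖ = a * ‖x - y‖ := by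
      rw [← smul_sub, norm_smul, Real.norm_of_nonneg ha.le, sub_sub_sub_cancel_right]
    rw [h1, ← ENNReal.ofReal_mul (by positivity), Real.mul_rpow ha.le (norm_nonneg _)]
    congr 1
    have : 0 < a ^ ((d : ℝ) + s * p) := by positivity
    rw [← mul_div_assoc, mul_div_mul_left _ _ this.ne']
  rw [gagliardoPow_eq_iterated (aemeasurable_rescale ha c hf), gagliardoPow_eq_iterated hf]
  simp_rw [hdens]
  have h2 : ∀ x, ∫⁻ y, ENNReal.ofReal (a ^ ((d : ℝ) + s * p)) *
      gagDens s p f (a • (x - c)) (a • (y - c)) = ENNReal.ofReal (a ^ ((d : ℝ) + s * p)) *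
        (ENNReal.ofReal (a ^ d)⁻¹ * ∫⁻ y, gagDens s p f (a • (x - c)) y) := fun x ↦ by
    rw [lintegral_const_mul' _ _ ENNReal.ofReal_ne_top, lintegral_comp_smul_sub ha c]
  simp_rw [h2]
  rw [lintegral_const_mul' _ _ ENNReal.ofReal_ne_top,
    lintegral_const_mul' _ _ ENNReal.ofReal_ne_top,
    lintegral_comp_smul_sub ha c fun x ↦ ∫⁻ y, gagDens s p f x y, ← mul_assoc, ← mul_assoc,
    ← ENNReal.ofReal_mul (by positivity), ← ENNReal.ofReal_mul (by positivity)]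
  congr 2
  rw [← Real.rpow_natCast, ← Real.rpow_neg ha.le, ← Real.rpow_add ha, ← Real.rpow_add ha]
  congr 1
  ring

lemma memD_rescale (hs0 : 0 < s) (hp : 1 < p) (hd : s * p < d) {a : ℝ} (ha : 0 < a) (c : Euc d)
    (hf : MemD s p f) : MemD s p (rescale a c f) := by
  obtain ⟨h1, h2, h3⟩ := (memD_iff hs0 hp hd).1 hf
  refine (memD_iff hs0 hp hd).2 ⟨aemeasurable_rescale ha c h1, ?_, ?_⟩
  · rw [powInt_rescale ha]
    exact ENNReal.mul_lt_top ENNReal.ofReal_lt_top h2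
  · rw [gagliardoPow_rescale ha c h1]
    exact ENNReal.mul_lt_top ENNReal.ofReal_lt_top h3

lemma coupling_univ_rescale {a : ℝ} (ha : 0 < a) (c : Euc d) :
    coupling 0 α β Set.univ (rescale a c f) (rescale a c g) =
      ENNReal.ofReal (a ^ d)⁻¹ * coupling 0 α β Set.univ f g := by
  unfold coupling
  simp only [Measure.restrict_univ, Real.rpow_zero, div_one]
  exact lintegral_comp_smul_sub ha c fun x ↦ ENNReal.ofReal (|f x| ^ α * |g x| ^ β)

lemma coupling_univ_le_of_forall_eq_zero {m : ℝ} {U : Set (Euc d)} (hα : 0 < α) (hU : IsOpen U)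
    (hf : ∀ x, x ∉ U → f x = 0) : coupling m α β Set.univ f g ≤ coupling m α β U f g := by
  unfold coupling
  rw [Measure.restrict_univ, ← lintegral_indicator hU.measurableSet]
  refine lintegral_mono fun x ↦ ?_
  by_cases hx : x ∈ U
  · rw [Set.indicator_of_mem hx]
  · simp [hf x hx, Real.zero_rpow hα.ne']

end Rescaling

/-! ### Approximation by compactly supported functions -/

section Approximation

variable {d : ℕ} {s p : ℝ} {f : Euc d → ℝ}

lemma powInt_truncate_lt_top {r δ : ℝ} (hp : 0 < p) (hpr : p ≤ r) (hδ : 0 < δ)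
    (hf : powInt r f < ∞) : powInt p (fun x ↦ max 0 (f x - δ)) < ∞ := by
  calc powInt p (fun x ↦ max 0 (f x - δ))
      ≤ ∫⁻ x, ENNReal.ofReal (δ ^ (p - r)) * ENNReal.ofReal (|f x| ^ r) := by
        refine lintegral_mono fun x ↦ ?_
        rw [← ENNReal.ofReal_mul (by positivity)]
        refine ENNReal.ofReal_le_ofReal ?_
        beta_reduce
        rcases le_or_gt (f x) δ with h | h
        · rw [max_eq_left (by linarith), abs_zero, Real.zero_rpow hp.ne']
          positivity
        · have hx : 0 < f x := hδ.trans h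
          rw [max_eq_right (by linarith), abs_of_pos (by linarith), abs_of_pos hx]
          calc (f x - δ) ^ p ≤ f x ^ p := Real.rpow_le_rpow (by linarith) (by linarith) hp.le
            _ = f x ^ (p - r) * f x ^ r := by
                rw [← Real.rpow_add hx]; simp
            _ ≤ _ := by
                gcongr 1
                exact Real.rpow_le_rpow_of_nonpos hδ h.le (by linarith)
    _ < ∞ := by
        rw [lintegral_const_mul' _ _ ENNReal.ofReal_ne_top]
        exact ENNReal.mul_lt_top ENNReal.ofReal_lt_top hf

/-- Compactly supported functions approximate the nonnegative elements of `D^{s,p}(ℝ^d)` from below.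
Lowering `f` by `δ` brings it into `L^p` without increasing the seminorm, after which a wide tent
function is an admissible cut-off. -/
lemma exists_seq_compactly_supported (hs0 : 0 < s) (hs1 : s < 1) (hp : 1 < p) (hd : s * p < d)
    (hf : MemD s p f) (hf0 : ∀ x, 0 ≤ f x) :
    ∃ w : ℕ → Euc d → ℝ, (∀ n, MemD s p (w n)) ∧
      (∀ n, ∃ R > 0, ∀ x, x ∉ Metric.ball (0 : Euc d) R → w n x = 0) ∧
      (∀ n x, |w n x| ≤ |f x|) ∧ (∀ x, Tendsto (fun n ↦ w n x) atTop (𝓝 (f x))) ∧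
      ∀ n, gagliardoPow s p (w n) ^ (1 / p) ≤
        gagliardoPow s p f ^ (1 / p) + ENNReal.ofReal (1 / ((n : ℝ) + 1)) := by
  have hp0 : 0 < p := by linarith
  have hr := lt_critExp hs0 hp hd
  obtain ⟨h1, h2, h3⟩ := (memD_iff hs0 hp hd).1 hf
  set v : ℕ → Euc d → ℝ := fun k x ↦ max 0 (f x - 1 / ((k : ℝ) + 1)) with hv_def
  have hv0 : ∀ k x, 0 ≤ v k x := fun k x ↦ le_max_left _ _
  have hvf : ∀ k x, v k x ≤ f x := fun k x ↦ max_le (hf0 x) (by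
    have : 0 < 1 / ((k : ℝ) + 1) := by positivity
    linarith)
  have hvm : ∀ k, AEMeasurable (v k) := fun k ↦ aemeasurable_const.max (h1.sub_const _)
  have hvg : ∀ k, gagliardoPow s p (v k) ≤ gagliardoPow s p f := fun k ↦
    gagliardoPow_mono hp0.le fun x y ↦ by
      refine (abs_max_sub_max_le_max _ _ _ _).trans ?_
      rw [sub_self, abs_zero, sub_sub_sub_cancel_right]
      exact max_le (abs_nonneg _) le_rfl
  have hvp : ∀ k, powInt p (v k) < ∞ := fun k ↦
    powInt_truncate_lt_top hp0 hr.le (by positivity) h2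
  have hN : ∀ k : ℕ, ∃ n : ℕ, k ≤ n ∧
      (powInt p (v k) * ∫⁻ z : Euc d, truncKer s p (1 / ((n : ℝ) + 1)) z) ^ (1 / p) ≤
        ENNReal.ofReal (1 / ((k : ℝ) + 1)) := by
    intro k
    have ht := ENNReal.Tendsto.const_mul (a := powInt p (v k))
      (tendsto_lintegral_truncKer (d := d) hs0 hs1 hp hd) (Or.inr (hvp k).ne)
    have ht2 := ((ENNReal.continuous_rpow_const (y := 1 / p)).tendsto _).comp ht
    rw [mul_zero, ENNReal.zero_rpow_of_pos (by positivity)] at ht2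
    have hpos : (0 : ℝ≥0∞) < ENNReal.ofReal (1 / ((k : ℝ) + 1)) := by
      rw [ENNReal.ofReal_pos]; positivity
    obtain ⟨n, hn1, hn2⟩ := ((eventually_ge_atTop k).and (ht2.eventually_le_const hpos)).exists
    exact ⟨n, hn1, hn2⟩
  choose N hNk hN using hN
  set τ : ℕ → Euc d → ℝ := fun k ↦ tent 0 ((N k : ℝ) + 1) with hτ
  have hR : ∀ k, 0 < (N k : ℝ) + 1 := fun k ↦ by positivity
  have hwf : ∀ k x, |v k x * τ k x| ≤ |f x| := fun k x ↦ by
    have e1 := tent_nonneg 0 ((N k : ℝ) + 1) x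
    have e2 := tent_le_one 0 (hR k) x
    rw [abs_of_nonneg (hf0 x), abs_of_nonneg (mul_nonneg (hv0 k x) e1)]
    calc v k x * τ k x ≤ v k x * 1 := mul_le_mul_of_nonneg_left e2 (hv0 k x)
      _ ≤ f x := by rw [mul_one]; exact hvf k x
  have hwg : ∀ k, gagliardoPow s p (fun x ↦ v k x * τ k x) ^ (1 / p) ≤
      gagliardoPow s p f ^ (1 / p) + ENNReal.ofReal (1 / ((k : ℝ) + 1)) := fun k ↦ by
    refine (gagliardoPow_mul_tent_le hp (hvm k) 0 (hR k)).trans ?_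
    have := hvg k
    have := hN k
    gcongr
  refine ⟨fun k x ↦ v k x * τ k x, fun k ↦ ?_, fun k ↦ ⟨_, hR k, fun x hx ↦ ?_⟩, hwf,
    fun x ↦ ?_, hwg⟩
  · refine (memD_iff hs0 hp hd).2
      ⟨(hvm k).mul (continuous_tent _ _).measurable.aemeasurable, ?_, ?_⟩
    · exact (powInt_mono (by linarith) (hwf k)).trans_lt h2
    · have hlt : gagliardoPow s p (fun x ↦ v k x * τ k x) ^ (1 / p) < ∞ :=
        (hwg k).trans_lt (ENNReal.add_lt_top.2
          ⟨ENNReal.rpow_lt_top_of_nonneg (by positivity) h3.ne, ENNReal.ofReal_lt_top⟩)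
      by_contra htop
      rw [not_lt, top_le_iff] at htop
      rw [htop, ENNReal.top_rpow_of_pos (by positivity)] at hlt
      exact lt_irrefl _ hlt
  · rw [hτ]
    simp only
    rw [tent_eq_zero (hR k) hx, mul_zero]
  · have t1 : Tendsto (fun k ↦ v k x) atTop (𝓝 (max 0 (f x - 0))) :=
      tendsto_const_nhds.max (tendsto_const_nhds.sub tendsto_one_div_add_atTop_nhds_zero_nat)
    have hNt : Tendsto (fun k ↦ (N k : ℝ) + 1) atTop atTop :=
      tendsto_atTop_add_const_right _ _ (tendsto_natCast_atTop_atTop.comp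
        (tendsto_atTop_mono hNk tendsto_id))
    have t2 : Tendsto (fun k ↦ τ k x) atTop (𝓝 (max 0 (1 - 0))) :=
      tendsto_const_nhds.max (tendsto_const_nhds.sub (hNt.const_div_atTop ‖x - 0‖))
    have t3 := t1.mul t2
    rw [sub_zero, sub_zero, max_eq_right (hf0 x), max_eq_right zero_le_one, mul_one] at t3
    exact t3

end Approximation

/-! ### The critical case -/

section Critical

variable {d : ℕ} {s p α β : ℝ} {U : Set (Euc d)} {f g u v : Euc d → ℝ}

/-- In the critical case both sides of the inequality scale alike, so that the best constant of an
arbitrary open set works for functions with support in any ball. -/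
lemma bestConst_mul_coupling_univ_le_of_support (hs0 : 0 < s) (hp : 1 < p) (hd : s * p < d)
    (hα : 1 < α) (hβ : 1 < β) (hq : α + β = critExp d s p 0) (hU : IsOpen U) (hne : U.Nonempty)
    (hf : MemD s p f) (hg : MemD s p g) {R : ℝ} (hR : 0 < R)
    (hfR : ∀ x, x ∉ Metric.ball (0 : Euc d) R → f x = 0)
    (hgR : ∀ x, x ∉ Metric.ball (0 : Euc d) R → g x = 0) :
    bestConst s p 0 α β U * coupling 0 α β Set.univ f g ^ (p / (α + β)) ≤
      gagliardoPow s p f + gagliardoPow s p g := by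
  have hsp : 0 < s * p := by positivity
  have hd0 : (0 : ℝ) < d := by linarith
  have hds : 0 < (d : ℝ) - s * p := by linarith
  obtain ⟨c, hc⟩ := hne
  obtain ⟨ρ, hρ, hB⟩ := Metric.isOpen_iff.1 hU c hc
  set a := R / ρ with ha_def
  have ha : 0 < a := by positivity
  have hsupp : ∀ {h : Euc d → ℝ}, (∀ x, x ∉ Metric.ball (0 : Euc d) R → h x = 0) →
      ∀ x, x ∉ U → rescale a c h x = 0 := fun hh x hx ↦ by
    refine hh _ fun hmem ↦ hx (hB ?_)
    rw [mem_ball_zero_iff, norm_smul, Real.norm_of_nonneg ha.le, ha_def, div_mul_eq_mul_div,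
      div_lt_iff₀ hρ, mul_lt_mul_iff_right₀ hR] at hmem
    rwa [mem_ball_iff_norm]
  have hexp : p / (α + β) = (d - s * p) / d := by
    have := critExp_mul hd
    rw [hq, div_eq_div_iff (by have := lt_critExp hs0 hp hd; linarith) hd0.ne']
    linarith
  set κ := ENNReal.ofReal (a ^ (s * p - d)) with hκ
  have hκ0 : κ ≠ 0 := by
    rw [hκ, ne_eq, ENNReal.ofReal_eq_zero, not_le]
    positivity
  have hκe : ENNReal.ofReal (a ^ d)⁻¹ ^ (p / (α + β)) = κ := by
    rw [ENNReal.ofReal_rpow_of_pos (by positivity), hκ, ← Real.rpow_natCast, ← Real.rpow_neg ha.le,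
      ← Real.rpow_mul ha.le, hexp]
    congr 2
    field_simp
    ring
  have hTf : MemW0 s p U (rescale a c f) :=
    ⟨memD_rescale hs0 hp hd ha c hf, Eventually.of_forall (hsupp hfR)⟩
  have hTg : MemW0 s p U (rescale a c g) :=
    ⟨memD_rescale hs0 hp hd ha c hg, Eventually.of_forall (hsupp hgR)⟩
  have hq0 : 0 ≤ p / (α + β) := by apply div_nonneg <;> linarith
  have h1 : bestConst s p 0 α β U *
      coupling 0 α β Set.univ (rescale a c f) (rescale a c g) ^ (p / (α + β)) ≤
      gagliardoPow s p (rescale a c f) + gagliardoPow s p (rescale a c g) := by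
    refine le_trans ?_ (bestConst_mul_le (m := 0) hp hα hβ hTf hTg)
    gcongr
    exact coupling_univ_le_of_forall_eq_zero (by linarith) hU (hsupp hfR)
  rw [coupling_univ_rescale ha, gagliardoPow_rescale ha c hf.aemeasurable,
    gagliardoPow_rescale ha c hg.aemeasurable, ENNReal.mul_rpow_of_nonneg _ _ hq0, hκe, ← mul_add,
    mul_left_comm, ENNReal.mul_le_mul_iff_right hκ0 ENNReal.ofReal_ne_top] at h1
  exact h1

/-- In the critical case the best constant of any nonempty open set is a lower bound for the
quotient on all of `D^{s,p}(ℝ^d)`. -/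
theorem bestConst_mul_coupling_univ_le (hs0 : 0 < s) (hs1 : s < 1) (hp : 1 < p) (hd : s * p < d)
    (hα : 1 < α) (hβ : 1 < β) (hq : α + β = critExp d s p 0) (hU : IsOpen U) (hne : U.Nonempty)
    (hf : MemD s p f) (hg : MemD s p g) (hf0 : ∀ x, 0 ≤ f x) (hg0 : ∀ x, 0 ≤ g x) :
    bestConst s p 0 α β U * coupling 0 α β Set.univ f g ^ (p / (α + β)) ≤
      gagliardoPow s p f + gagliardoPow s p g := by
  have hp0 : 0 < p := by linarith
  obtain ⟨w, hwD, hwR, hwf, hwt, hwg⟩ := exists_seq_compactly_supported hs0 hs1 hp hd hf hf0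
  obtain ⟨z, hzD, hzR, hzf, hzt, hzg⟩ := exists_seq_compactly_supported hs0 hs1 hp hd hg hg0
  have hlim : Tendsto (fun n ↦ coupling 0 α β Set.univ (w n) (z n)) atTop
      (𝓝 (coupling 0 α β Set.univ f g)) := by
    refine tendsto_of_le_liminf_of_limsup_le ?_ ?_
    · calc coupling 0 α β Set.univ f g
          ≤ ∫⁻ x in Set.univ, liminf (fun n ↦ couplingDens 0 α β (w n) (z n) x) atTop := by
            refine lintegral_mono fun x ↦ le_of_eq (Tendsto.liminf_eq ?_).symm
            refine ENNReal.tendsto_ofReal (Tendsto.div_const ?_ _)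
            exact ((hwt x).abs.rpow_const (Or.inr (by linarith))).mul
              ((hzt x).abs.rpow_const (Or.inr (by linarith)))
        _ ≤ _ := lintegral_liminf_le' fun n ↦
            (aemeasurable_couplingDens (hwD n).aemeasurable (hzD n).aemeasurable).restrict
    · refine (limsup_le_limsup (Eventually.of_forall fun n ↦
        coupling_mono (by linarith) (by linarith) (hwf n) (hzf n))).trans ?_
      rw [limsup_const]
  have hleft : Tendsto (fun n ↦ bestConst s p 0 α β U *
      coupling 0 α β Set.univ (w n) (z n) ^ (p / (α + β))) atTop
      (𝓝 (bestConst s p 0 α β U * coupling 0 α β Set.univ f g ^ (p / (α + β)))) :=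
    ENNReal.Tendsto.const_mul ((ENNReal.continuous_rpow_const.tendsto _).comp hlim)
      (Or.inr (bestConst_lt_top hs0 hs1 hp hd hα hβ hU hne).ne)
  have hpow : ∀ {A B : ℝ≥0∞} {δ : ℝ≥0∞}, A ^ (1 / p) ≤ B ^ (1 / p) + δ →
      A ≤ (B ^ (1 / p) + δ) ^ p := fun {A B δ} h ↦ by
    calc A = (A ^ (1 / p)) ^ p := by
          rw [← ENNReal.rpow_mul, one_div, inv_mul_cancel₀ hp0.ne', ENNReal.rpow_one]
      _ ≤ _ := ENNReal.rpow_le_rpow h hp0.le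
  have hright : ∀ A : ℝ≥0∞, Tendsto (fun n : ℕ ↦ (A ^ (1 / p) +
      ENNReal.ofReal (1 / ((n : ℝ) + 1))) ^ p) atTop (𝓝 A) := fun A ↦ by
    have h1 : Tendsto (fun n : ℕ ↦ A ^ (1 / p) + ENNReal.ofReal (1 / ((n : ℝ) + 1))) atTop
        (𝓝 (A ^ (1 / p) + ENNReal.ofReal 0)) :=
      tendsto_const_nhds.add (ENNReal.tendsto_ofReal tendsto_one_div_add_atTop_nhds_zero_nat)
    have h2 := (ENNReal.continuous_rpow_const (y := p)).tendsto _ |>.comp h1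
    rw [ENNReal.ofReal_zero, add_zero, ← ENNReal.rpow_mul, one_div, inv_mul_cancel₀ hp0.ne',
      ENNReal.rpow_one] at h2
    rw [one_div]
    exact h2
  refine le_of_tendsto_of_tendsto' hleft ((hright _).add (hright _)) fun n ↦ ?_
  obtain ⟨R₁, hR₁, hw0⟩ := hwR n
  obtain ⟨R₂, hR₂, hz0⟩ := hzR n
  refine (bestConst_mul_coupling_univ_le_of_support hs0 hp hd hα hβ hq hU hne (hwD n) (hzD n)
    (lt_max_of_lt_left hR₁ : 0 < max R₁ R₂) (fun x hx ↦ hw0 x fun h ↦ hx ?_)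
    (fun x hx ↦ hz0 x fun h ↦ hx ?_)).trans (add_le_add (hpow (hwg n)) (hpow (hzg n)))
  · exact Metric.ball_subset_ball (le_max_left _ _) h
  · exact Metric.ball_subset_ball (le_max_right _ _) h

/-- In the critical case a ground state on `U` would be a minimizer on the whole space, hence
positive almost everywhere by the maximum principle, although it vanishes outside `U`. -/
theorem not_isGroundState_of_critical (hs0 : 0 < s) (hs1 : s < 1) (hp : 1 < p) (hd : s * p < d)
    (hα : 1 < α) (hβ : 1 < β) (hq : α + β = critExp d s p 0) (hU : IsOpen U)
    (hUc : volume Uᶜ ≠ 0) : ¬ IsGroundState s p 0 α β U u v := by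
  intro h
  have hne : U.Nonempty := by
    rw [Set.nonempty_iff_ne_empty]
    rintro rfl
    refine h.1.2 ?_
    filter_upwards [h.1.1.2] with x hx
    exact hx (Set.notMem_empty x)
  have h' := h.abs hs0 hp hd
  have heq := h'.gagliardoPow_add_eq hs0 hs1 hp hd hα hβ hU hne
    (coupling_lt_top_of_critical hs0 hp hd hα hβ hq h'.1.1.1 h'.2.1.1.1).ne
  obtain ⟨hu, hv, -⟩ := h'
  set u' : Euc d → ℝ := fun x ↦ |u x|
  set v' : Euc d → ℝ := fun x ↦ |v x|
  have hu0 : ∀ x, 0 ≤ u' x := fun x ↦ abs_nonneg _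
  have hv0 : ∀ x, 0 ≤ v' x := fun x ↦ abs_nonneg _
  have hq0 : 0 ≤ p / (α + β) := by apply div_nonneg <;> linarith
  have hpos : ∀ n : ℕ, ∀ᵐ x, 0 < tent 0 ((n : ℝ) + 1) x → 0 < u' x := by
    intro n
    have hR : 0 < (n : ℝ) + 1 := by positivity
    have hT := memD_tent hs0 hs1 hp hd (0 : Euc d) hR
    refine ae_pos_of_gagliardoPow_le_max hp hu.1.1.aemeasurable hu0 hu.2 hu.1.1.2
      hT.aemeasurable (tent_nonneg _ _) (tent_le_one _ hR) hT.2 fun ε hε ↦ ?_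
    have hw := memD_max hs0 hp hd hu.1.1 (memD_const_mul hs0 hp hd hT ε)
    have hw0 : ∀ x, u' x ≤ max (u' x) (ε * tent 0 ((n : ℝ) + 1) x) := fun x ↦ le_max_left _ _
    have h2 := bestConst_mul_coupling_univ_le hs0 hs1 hp hd hα hβ hq hU hne hw hv.1.1
      (fun x ↦ (hu0 x).trans (hw0 x)) hv0
    refine (ENNReal.add_le_add_iff_right hv.1.1.2.ne).1 (le_trans ?_ h2)
    rw [heq]
    gcongr
    refine le_trans ?_ (coupling_mono (u := u') (by linarith) (by linarith) (fun x ↦ ?_)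
      fun x ↦ le_rfl)
    · exact lintegral_mono' (Measure.restrict_mono_set _ (Set.subset_univ U)) le_rfl
    · rw [abs_of_nonneg (hu0 x), abs_of_nonneg ((hu0 x).trans (hw0 x))]
      exact hw0 x
  apply hUc
  rw [measure_eq_zero_iff_ae_notMem]
  filter_upwards [ae_all_iff.2 hpos, hu.1.2] with x hx hxU hmem
  obtain ⟨n, hn⟩ := exists_nat_gt ‖x‖
  have := hx n (tent_pos (by positivity) (by rw [mem_ball_zero_iff]; linarith))
  rw [hxU hmem] at this
  exact lt_irrefl _ this

end Critical

end FracSystem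

end

theorem proposition1p1 (d : ℕ) (s p m q α β : ℝ)
    (hs0 : 0 < s) (hs1 : s < 1) (hp : 1 < p) (hd : s * p < (d : ℝ))
    (hm0 : 0 ≤ m) (hm1 : m ≤ s * p)
    (hpq : p ≤ q) (hqc : q ≤ FracSystem.critExp d s p m)
    (hα : 1 < α) (hβ : 1 < β) (hαβ : α + β = q)
    (Ω : Set (EuclideanSpace ℝ (Fin d)))
    (hΩo : IsOpen Ω) (hΩb : Bornology.IsBounded Ω) (hΩ0 : (0 : EuclideanSpace ℝ (Fin d)) ∈ Ω) :
    -- (i) existence of a ground state, positive in `Ω`, in the subcritical case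
    (q < FracSystem.critExp d s p m →
      ∃ u v : EuclideanSpace ℝ (Fin d) → ℝ,
        FracSystem.IsGroundState s p m α β Ω u v ∧
        ∀ᵐ x ∂(volume.restrict Ω), 0 < u x ∧ 0 < v x) ∧
    -- (ii) non-existence in the critical case `q = p*_s` (which forces `m = 0`): on `Ω`, and on
    -- every open set, bounded or not, whose complement is not Lebesgue-null
    (q = FracSystem.critExp d s p 0 →
      (¬ ∃ u v : EuclideanSpace ℝ (Fin d) → ℝ, FracSystem.IsGroundState s p m α β Ω u v) ∧
      ∀ U : Set (EuclideanSpace ℝ (Fin d)), IsOpen U → volume Uᶜ ≠ 0 →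
        ¬ ∃ u v : EuclideanSpace ℝ (Fin d) → ℝ, FracSystem.IsGroundState s p m α β U u v) := by
  subst hαβ
  have hsp : 0 < s * p := by positivity
  have hd0 : (0 : ℝ) < d := by linarith
  refine ⟨fun hq ↦ ?_, fun hq ↦ ?_⟩
  · obtain ⟨u, v, h⟩ :=
      FracSystem.exists_isGroundState hs0 hs1 hp hd hm0 hα hβ hq hΩo hΩb ⟨0, hΩ0⟩
    have h' := h.abs hs0 hp hd
    exact ⟨_, _, h', h'.ae_pos hs0 hs1 hp hd hα hβ hΩo ⟨0, hΩ0⟩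
      (FracSystem.coupling_lt_top_of_subcritical hs0 hp hd hm0 hα hβ hq hΩb h'.1.1.1 h'.2.1.1.1).ne
      (fun x ↦ abs_nonneg _) fun x ↦ abs_nonneg _⟩
  · -- `p*_s(0) ≤ p*_s(m)` forces `m = 0`
    have hm : m = 0 := by
      have hds : 0 < (d : ℝ) - s * p := by linarith
      rw [hq, FracSystem.critExp, FracSystem.critExp, div_le_div_iff_of_pos_right hds] at hqc
      nlinarith
    subst hm
    have hU : ∀ U : Set (EuclideanSpace ℝ (Fin d)), IsOpen U → volume Uᶜ ≠ 0 →
        ¬ ∃ u v : EuclideanSpace ℝ (Fin d) → ℝ, FracSystem.IsGroundState s p 0 α β U u v := by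
      rintro U hUo hUc ⟨u, v, h⟩
      exact FracSystem.not_isGroundState_of_critical hs0 hs1 hp hd hα hβ hq hUo hUc h
    refine ⟨hU Ω hΩo fun h0 ↦ ?_, hU⟩
    have := FracSystem.nontrivial_euc hd0
    have h1 : (volume : Measure (EuclideanSpace ℝ (Fin d))) Set.univ < ∞ := by
      rw [← Set.union_compl_self Ω]
      exact (measure_union_le _ _).trans_lt
        (ENNReal.add_lt_top.2 ⟨hΩb.measure_lt_top, by rw [h0]; exact ENNReal.zero_lt_top⟩)
    have : NoncompactSpace (EuclideanSpace ℝ (Fin d)) := NormedSpace.noncompactSpace ℝ _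
    rw [measure_univ_of_isAddLeftInvariant] at h1
    exact lt_irrefl _ h1
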